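/- Let $d\ge 1$ be an integer, and let $X=\mathbb{R}\times\mathbb{R}^d$ carry the Lebesgue measure $dt\,dx$ and the parabolic distance $\rho((t,x),(s,y))=\sqrt{|t-s|}+|x-y|$, with open balls $B_r(t,x)=\{(s,y):\rho((t,x),(s,y))<r\}$. For $1<p,q<\infty$ and $0<\beta<\frac2p+\frac dq$ let $E_{p,q,\beta}$ (resp. $F_{p,q,\beta}$) be the space of locally integrable functions $f$ on $X$ (real- or complex-valued) for which $$\|f\|_{E_{p,q,\beta}}=\sup_{r>0,\,t\in\mathbb{R},\,x\in\mathbb{R}^d} r^{\beta-\frac2p-\frac dq}\Big(\int_{|t-s|<r^2}\Big(\int_{|x-y|<r}|f(s,y)|^q\,dy\Big)^{p/q}ds\Big)^{1/p}<\infty$$ $$\Big(\text{resp. } \|f\|_{F_{p,q,\beta}}=\sup_{r>0,\,t\in\mathbb{R},\,x\in\mathbb{R}^d} r^{\beta-\frac2p-\frac dq}\Big(\int_{|x-y|<r}\Big(\int_{|t-s|<r^2}|f(s,y)|^p\,ds\Big)^{q/p}dy\Big)^{1/q}<\infty\Big).$$ Define the parabolic Hardy–Littlewood maximal function and, for $0<\alpha<d+2$,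 the parabolic Riesz potential by $$\mathcal{M}_f(z)=\sup_{r>0}\frac1{|B_r(z)|}\int_{B_r(z)}|f(w)|\,dw,\qquad \mathcal{I}_\alpha f(z)=\int_X\frac{f(w)}{\rho(z,w)^{d+2-\alpha}}\,dw .$$ Let $1<p,q<\infty$ and $0<\beta<\frac2p+\frac dq$. Then, with constants $C$ depending only on $d,p,q,\beta$: a) For every $f\in E_{p,q,\beta}$ one has $\mathcal{M}_f\in E_{p,q,\beta}$ (in particular $\mathcal{M}_f<\infty$ almost everywhere) and $\|\mathcal{M}_f\|_{E_{p,q,\beta}}\le C\|f\|_{E_{p,q,\beta}}$; the same holds with $F_{p,q,\beta}$ in place of $E_{p,q,\beta}$. b) If $\beta>1$, then for every $f\in E_{p,q,\beta}$ the integral defining $\mathcal{I}_1f(z)$ converges absolutely for almost every $z\in X$, $\mathcal{I}_1f\in E_{\frac{\beta}{\beta-1}p,\frac{\beta}{\beta-1}q,\beta-1}$, and $\|\mathcal{I}_1f\|_{E_{\frac{\beta}{\beta-1}p,\frac{\beta}{\beta-1}q,\beta-1}}\le C\|f\|_{E_{p,q,\beta}}$; the same holds with $F$ in place of $E$ throughout.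 c) If $\beta>2$, then for every $f\in E_{p,q,\beta}$ the integral defining $\mathcal{I}_2f(z)$ converges absolutely for almost every $z\in X$, $\mathcal{I}_2f\in E_{\frac{\beta}{\beta-2}p,\frac{\beta}{\beta-2}q,\beta-2}$, and $\|\mathcal{I}_2f\|_{E_{\frac{\beta}{\beta-2}p,\frac{\beta}{\beta-2}q,\beta-2}}\le C\|f\|_{E_{p,q,\beta}}$; the same holds with $F$ in place of $E$ throughout. -/

import Mathlib

open MeasureTheory
open scoped ENNReal NNReal

noncomputable section

namespace ParabolicMorrey

/-- The space-time `ℝ × ℝ^d`, with the Euclidean norm on `ℝ^d`; its `volume` is the Lebesgue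
measure `dt dx`. -/
abbrev SpaceTime (d : ℕ) : Type := ℝ × EuclideanSpace ℝ (Fin d)

/-- The parabolic distance `√|t - s| + |x - y|`. -/
def pdist {d : ℕ} (z w : SpaceTime d) : ℝ :=
  Real.sqrt |z.1 - w.1| + ‖z.2 - w.2‖

/-- The open parabolic ball of centre `z` and radius `r`. -/
def pball {d : ℕ} (z : SpaceTime d) (r : ℝ) : Set (SpaceTime d) :=
  {w | pdist z w < r}

/-- The (possibly infinite) norm
`sup_{r, t, x} r^(β - 2/p - d/q) (∫_{|t-s|<r²} (∫_{|x-y|<r} |f(s,y)|^q dy)^(p/q) ds)^(1/p)`.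
The codomain may be a normed space or `ℝ≥0∞`. -/
def normE {d : ℕ} {V : Type*} [ENorm V] (p q β : ℝ) (f : SpaceTime d → V) : ℝ≥0∞ :=
  ⨆ (r : ℝ) (_ : 0 < r) (t : ℝ) (x : EuclideanSpace ℝ (Fin d)),
    ENNReal.ofReal (r ^ (β - 2 / p - d / q)) *
      (∫⁻ s in Metric.ball t (r ^ 2),
        (∫⁻ y in Metric.ball x r, ‖f (s, y)‖ₑ ^ q) ^ (p / q)) ^ (1 / p)

/-- The (possibly infinite) norm
`sup_{r, t, x} r^(β - 2/p - d/q) (∫_{|x-y|<r} (∫_{|t-s|<r²} |f(s,y)|^p ds)^(q/p) dy)^(1/q)`. -/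
def normF {d : ℕ} {V : Type*} [ENorm V] (p q β : ℝ) (f : SpaceTime d → V) : ℝ≥0∞ :=
  ⨆ (r : ℝ) (_ : 0 < r) (t : ℝ) (x : EuclideanSpace ℝ (Fin d)),
    ENNReal.ofReal (r ^ (β - 2 / p - d / q)) *
      (∫⁻ y in Metric.ball x r,
        (∫⁻ s in Metric.ball t (r ^ 2), ‖f (s, y)‖ₑ ^ p) ^ (q / p)) ^ (1 / q)

/-- Membership in `E_{p,q,β}`: local integrability (which includes a.e. measurability, and a.e.
finiteness if `f` is `ℝ≥0∞`-valued) and finite norm. -/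
def MemE {d : ℕ} {V : Type*} [TopologicalSpace V] [ContinuousENorm V] (p q β : ℝ)
    (f : SpaceTime d → V) : Prop :=
  LocallyIntegrable f ∧ normE p q β f < ∞

/-- Membership in `F_{p,q,β}`: local integrability and finite norm. -/
def MemF {d : ℕ} {V : Type*} [TopologicalSpace V] [ContinuousENorm V] (p q β : ℝ)
    (f : SpaceTime d → V) : Prop :=
  LocallyIntegrable f ∧ normF p q β f < ∞

/-- The parabolic Hardy–Littlewood maximal function, with values in `[0, ∞]`. -/
def maximal {d : ℕ} {V : Type*} [ENorm V] (f : SpaceTime d → V) (z : SpaceTime d) : ℝ≥0∞ :=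
  ⨆ (r : ℝ) (_ : 0 < r), (volume (pball z r))⁻¹ * ∫⁻ w in pball z r, ‖f w‖ₑ

/-- The kernel `1 / ρ(z, w)^(Q - α)` of the parabolic Riesz potential, where `Q = d + 2`. -/
def rieszKernel {d : ℕ} (α : ℝ) (z w : SpaceTime d) : ℝ :=
  1 / pdist z w ^ ((d : ℝ) + 2 - α)

/-- The integral that defines the Riesz potential of `f` at `z` converges absolutely. -/
def RieszConverges {d : ℕ} {V : Type*} [NormedAddCommGroup V] [NormedSpace ℝ V] (α : ℝ)
    (f : SpaceTime d → V) (z : SpaceTime d) : Prop :=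
  Integrable (fun w => rieszKernel α z w • f w)

/-- The parabolic Riesz potential `I_α f`; meaningful at the points where `RieszConverges α f`. -/
def riesz {d : ℕ} {V : Type*} [NormedAddCommGroup V] [NormedSpace ℝ V] (α : ℝ)
    (f : SpaceTime d → V) (z : SpaceTime d) : V :=
  ∫ w, rieszKernel α z w • f w

end ParabolicMorrey

end

open ParabolicMorrey

open MeasureTheory
open scoped ENNReal NNReal

noncomputable section

namespace ParabolicMorrey

/-! Up to notation, the `E`-norm is an `L^p(L^q)` Morrey norm over cylinders with radii `r^2` in
time and `r` in space. The `F`-norm is the same object with the two factors exchanged. Everything is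
therefore proved once, on a product `X × Y` with dilations `(r^a, r^b)`. Parabolic balls are
comparable to cylinders.

Maximal function. On a cylinder of radius `r`, averages at scales at most `r` only see `f` on the
doubled cylinder. They are controlled by the iterated one-variable maximal function `iterMax`, which
is bounded on `L^p(L^q)`. At scales `R > r`, Hölder and the Morrey norm `N` bound the average by a
multiple of `R^(-β) N ≤ r^(-β) N`, a constant of the right size (`cylMax_le_on_cyl`).

Boundedness of `iterMax` needs a maximal inequality for `L^q`-valued functions
(`exists_lintegral_partialMax_le`). It rests on the weighted inequality `∫ (Mf)^q φ ≤ C ∫ f^q Mφ`.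
The case `p = q` is Fubini, `p > q` is duality against weights `φ`, and `p < q` is an extrapolation
argument with an `A₁` weight from the Rubio de Francia algorithm (`exists_majorant`).

Riesz potential. The kernel is a superposition over scales of indicators of balls. Splitting the
scales at `R` bounds the potential by `R^α M + R^(α-β) N`, up to constants. The choice `R^β = N / M`
gives Hedberg's bound `M^θ N^(1-θ)` with `θ = (β - α)/β` (`cylPotential_le`). Taking the power `θ`
of the maximal function divides `p` and `q` by `θ` and turns `β` into `β - α`, so the bound follows
from the one for the maximal function. -/

set_option linter.unusedSectionVars false

/-! ### Dyadic maximal function and the weighted weak type inequality. -/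

section Maximal

variable {X : Type*} [NormedAddCommGroup X] [NormedSpace ℝ X] [FiniteDimensional ℝ X]
  [MeasureSpace X] [BorelSpace X] [(volume : Measure X).IsAddHaarMeasure]

/-- The centred Hardy–Littlewood maximal function over balls of dyadic radii. -/
def dyadicMax (f : X → ℝ≥0∞) (x : X) : ℝ≥0∞ :=
  ⨆ k : ℤ, (volume (Metric.closedBall x ((2 : ℝ) ^ k)))⁻¹ *
    ∫⁻ y in Metric.closedBall x ((2 : ℝ) ^ k), f y

lemma volume_closedBall_ne_zero (x : X) {r : ℝ} (hr : 0 < r) :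
    volume (Metric.closedBall x r) ≠ 0 :=
  (Metric.measure_closedBall_pos volume x hr).ne'

lemma volume_closedBall_ne_top (x : X) (r : ℝ) : volume (Metric.closedBall x r) ≠ ∞ :=
  (isCompact_closedBall x r).measure_lt_top.ne

lemma volume_closedBall_two_zpow_mul (x y : X) (k : ℤ) (m : ℕ) :
    volume (Metric.closedBall y ((2 : ℝ) ^ (k + m))) =
      ENNReal.ofReal ((2 ^ m) ^ Module.finrank ℝ X) *
        volume (Metric.closedBall x ((2 : ℝ) ^ k)) := by
  have h2 : (0 : ℝ) < 2 ^ k := by positivity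
  rw [Measure.addHaar_closedBall _ _ (by positivity), Measure.addHaar_closedBall _ _ h2.le,
    ← mul_assoc, ← ENNReal.ofReal_mul (by positivity), ← mul_pow, zpow_add₀ (by norm_num),
    zpow_natCast, mul_comm ((2 : ℝ) ^ k)]

lemma lintegral_closedBall_two_zpow_le (f : X → ℝ≥0∞) (x : X) (k : ℤ) :
    ∫⁻ y in Metric.closedBall x ((2 : ℝ) ^ k), f y ≤
      volume (Metric.closedBall x ((2 : ℝ) ^ k)) * dyadicMax f x := by
  have h := le_iSup (fun k : ℤ => (volume (Metric.closedBall x ((2 : ℝ) ^ k)))⁻¹ *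
    ∫⁻ y in Metric.closedBall x ((2 : ℝ) ^ k), f y) k
  exact (ENNReal.inv_mul_le_iff (volume_closedBall_ne_zero x (by positivity))
    (volume_closedBall_ne_top x _)).1 h

/-- Rounding `r` up to a power of two at most doubles it, hence the factor `2 ^ dim`. This is the
only cost of dyadic radii. -/
lemma lintegral_closedBall_le (f : X → ℝ≥0∞) (x : X) {r : ℝ} (hr : 0 < r) :
    ∫⁻ y in Metric.closedBall x r, f y ≤
      ENNReal.ofReal (2 ^ Module.finrank ℝ X) * volume (Metric.closedBall x r) *
        dyadicMax f x := by
  obtain ⟨k, hk, hk'⟩ := exists_mem_Ioc_zpow hr (one_lt_two : (1 : ℝ) < 2)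
  have h1 : volume (Metric.closedBall x ((2 : ℝ) ^ (k + 1))) ≤
      ENNReal.ofReal (2 ^ Module.finrank ℝ X) * volume (Metric.closedBall x r) := by
    have := volume_closedBall_two_zpow_mul x x k 1
    simp only [Nat.cast_one, pow_one] at this
    rw [this]
    gcongr
  calc _ ≤ ∫⁻ y in Metric.closedBall x ((2 : ℝ) ^ (k + 1)), f y :=
        lintegral_mono_set (Metric.closedBall_subset_closedBall hk')
    _ ≤ _ := (lintegral_closedBall_two_zpow_le f x _).trans (by gcongr)

/-- Dyadic radii make the supremum countable. The parameter in `Z` is carried along because maximal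
functions are later taken in one variable of a product. -/
lemma measurable_dyadicMax_uncurry {Z : Type*} [MeasurableSpace Z] {f : X × Z → ℝ≥0∞}
    (hf : Measurable f) :
    Measurable fun w : X × Z => dyadicMax (fun x => f (x, w.2)) w.1 := by
  unfold dyadicMax
  refine Measurable.iSup fun k => ?_
  have hc : ∀ w : X × Z, volume (Metric.closedBall w.1 ((2 : ℝ) ^ k)) =
      volume (Metric.closedBall (0 : X) ((2 : ℝ) ^ k)) := fun w => by
    rw [Measure.addHaar_closedBall_center]
  simp_rw [hc]
  refine Measurable.const_mul ?_ _
  have : ∀ w : X × Z, ∫⁻ y in Metric.closedBall w.1 ((2 : ℝ) ^ k), f (y, w.2) =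
      ∫⁻ y, ({v : (X × Z) × X | dist v.2 v.1.1 ≤ (2 : ℝ) ^ k}.indicator
        (fun v => f (v.2, v.1.2))) (w, y) := fun w => by
    rw [← lintegral_indicator Metric.isClosed_closedBall.measurableSet]
    rfl
  simp_rw [this]
  refine Measurable.lintegral_prod_right' (Measurable.indicator (by fun_prop) ?_)
  exact measurableSet_le (by fun_prop) measurable_const

lemma measurable_dyadicMax {f : X → ℝ≥0∞} (hf : Measurable f) : Measurable (dyadicMax f) := by
  have := measurable_dyadicMax_uncurry (Z := Unit) (f := fun w : X × Unit => f w.1) (by fun_prop)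
  have h2 : Measurable fun x : X => (x, ()) := by fun_prop
  have h3 := this.comp h2
  simp only [Function.comp_def] at h3
  exact h3

lemma dyadicMax_mono {f g : X → ℝ≥0∞} (h : ∀ x, f x ≤ g x) (x : X) :
    dyadicMax f x ≤ dyadicMax g x := by
  unfold dyadicMax
  gcongr
  exact h _

lemma dyadicMax_const_le (c : ℝ≥0∞) (x : X) : dyadicMax (fun _ => c) x ≤ c := by
  refine iSup_le fun k => ?_
  rw [setLIntegral_const, mul_comm c, ← mul_assoc]
  exact (mul_le_mul_left (ENNReal.inv_mul_le_one _) c).trans_eq (one_mul c)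

lemma dyadicMax_add_le {f g : X → ℝ≥0∞} (hf : Measurable f) (x : X) :
    dyadicMax (fun y => f y + g y) x ≤ dyadicMax f x + dyadicMax g x := by
  refine iSup_le fun k => ?_
  rw [lintegral_add_left hf, mul_add]
  exact add_le_add (le_iSup (fun k : ℤ => (volume (Metric.closedBall x ((2 : ℝ) ^ k)))⁻¹ *
    ∫⁻ y in Metric.closedBall x ((2 : ℝ) ^ k), f y) k)
    (le_iSup (fun k : ℤ => (volume (Metric.closedBall x ((2 : ℝ) ^ k)))⁻¹ *
    ∫⁻ y in Metric.closedBall x ((2 : ℝ) ^ k), g y) k)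

lemma dyadicMax_const_mul {f : X → ℝ≥0∞} (hf : Measurable f) (c : ℝ≥0∞) (x : X) :
    dyadicMax (fun y => c * f y) x = c * dyadicMax f x := by
  unfold dyadicMax
  rw [ENNReal.mul_iSup]
  congr with k
  rw [lintegral_const_mul c hf, mul_left_comm]

lemma dyadicMax_tsum_le {f : ℕ → X → ℝ≥0∞} (hf : ∀ n, Measurable (f n)) (x : X) :
    dyadicMax (fun y => ∑' n, f n y) x ≤ ∑' n, dyadicMax (f n) x := by
  refine iSup_le fun k => ?_
  rw [lintegral_tsum fun n => (hf n).aemeasurable, ← ENNReal.tsum_mul_left]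
  exact ENNReal.tsum_le_tsum fun n =>
    le_iSup (fun k : ℤ => (volume (Metric.closedBall x ((2 : ℝ) ^ k)))⁻¹ *
    ∫⁻ y in Metric.closedBall x ((2 : ℝ) ^ k), f n y) k

/-- Weak type inequality for a pair of weights `(φ, Mφ)`, radii bounded. -/
lemma weak_type_of_bddAbove_radius {f φ : X → ℝ≥0∞} (lam : ℝ≥0∞) (N : ℤ) :
    lam * ∫⁻ x in {x | ∃ k ≤ N, lam * volume (Metric.closedBall x ((2 : ℝ) ^ k)) <
        ∫⁻ y in Metric.closedBall x ((2 : ℝ) ^ k), f y}, φ x ≤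
      ENNReal.ofReal (8 ^ Module.finrank ℝ X) * ∫⁻ x, f x * dyadicMax φ x := by
  set t : Set (X × ℤ) := {w | w.2 ≤ N ∧ lam * volume (Metric.closedBall w.1 ((2 : ℝ) ^ w.2)) <
        ∫⁻ y in Metric.closedBall w.1 ((2 : ℝ) ^ w.2), f y} with ht
  obtain ⟨u, hut, hdis, hcov⟩ := Vitali.exists_disjoint_subfamily_covering_enlargement_closedBall
    t (fun w => w.1) (fun w => (2 : ℝ) ^ w.2) (2 ^ N)
    (fun a ha => zpow_le_zpow_right₀ (by norm_num) ha.1) 5 (by norm_num)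
  have hcount : u.Countable := hdis.countable_of_nonempty_interior fun i _ =>
    ⟨i.1, Metric.ball_subset_interior_closedBall (Metric.mem_ball_self (by positivity))⟩
  have := hcount.to_subtype
  have hsub : {x | ∃ k ≤ N, lam * volume (Metric.closedBall x ((2 : ℝ) ^ k)) <
        ∫⁻ y in Metric.closedBall x ((2 : ℝ) ^ k), f y} ⊆
      ⋃ b : u, Metric.closedBall b.1.1 (5 * 2 ^ b.1.2) := by
    rintro x ⟨k, hk, hx⟩
    obtain ⟨b, hb, hbs⟩ := hcov (x, k) ⟨hk, hx⟩
    exact Set.mem_iUnion.2 ⟨⟨b, hb⟩, hbs (Metric.mem_closedBall_self (by positivity))⟩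
  have hball : ∀ b ∈ u, lam * ∫⁻ x in Metric.closedBall b.1 (5 * 2 ^ b.2), φ x ≤
      ENNReal.ofReal (8 ^ Module.finrank ℝ X) *
        ∫⁻ x in Metric.closedBall b.1 (2 ^ b.2), f x * dyadicMax φ x := by
    rintro ⟨x, k⟩ hb
    have hlt := (hut hb).2
    simp only at hlt ⊢
    set S := ∫⁻ x in Metric.closedBall x (5 * 2 ^ k), φ x
    set V := volume (Metric.closedBall x ((2 : ℝ) ^ k)) with hV
    set D := ENNReal.ofReal (8 ^ Module.finrank ℝ X) with hD
    have hV0 : V ≠ 0 := volume_closedBall_ne_zero x (by positivity)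
    have hVt : V ≠ ∞ := volume_closedBall_ne_top x _
    have hD0 : D ≠ 0 := by simp [hD]
    have hDt : D ≠ ∞ := by simp [hD]
    -- For `y` in the selected ball, the fivefold ball lies in the ball of radius `2 ^ (k + 3)`
    -- around `y`, since `5 + 1 ≤ 8`. So the average of `φ` over it is seen by `dyadicMax φ y`; the
    -- constant `8 ^ dim` is the ratio of volumes.
    have hle : ∀ y ∈ Metric.closedBall x ((2 : ℝ) ^ k), S * (D * V)⁻¹ ≤ dyadicMax φ y := by
      intro y hy
      rw [← div_eq_mul_inv]
      refine ENNReal.div_le_of_le_mul' ?_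
      have h8 : volume (Metric.closedBall y ((2 : ℝ) ^ (k + (3 : ℕ)))) = D * V := by
        rw [volume_closedBall_two_zpow_mul x y k 3]
        norm_num [hD, hV]
      rw [← h8]
      refine le_trans (lintegral_mono_set ?_) (lintegral_closedBall_two_zpow_le φ y _)
      refine Metric.closedBall_subset_closedBall' ?_
      rw [Metric.mem_closedBall, dist_comm] at hy
      rw [zpow_add₀ (by norm_num)]
      norm_num
      nlinarith [zpow_pos (two_pos : (0 : ℝ) < 2) k]
    calc lam * S = D * ((lam * V) * (S * (D * V)⁻¹)) := by
          rw [ENNReal.mul_inv (Or.inl hD0) (Or.inl hDt)]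
          calc lam * S = (D * D⁻¹) * (V * V⁻¹) * (lam * S) := by
                rw [ENNReal.mul_inv_cancel hD0 hDt, ENNReal.mul_inv_cancel hV0 hVt]; simp
            _ = _ := by ring
      _ ≤ D * ((∫⁻ y in Metric.closedBall x ((2 : ℝ) ^ k), f y) * (S * (D * V)⁻¹)) := by gcongr
      _ ≤ D * ∫⁻ y in Metric.closedBall x ((2 : ℝ) ^ k), f y * (S * (D * V)⁻¹) := by
          gcongr
          exact lintegral_mul_const_le _ _
      _ ≤ _ := by
          gcongr D * ?_
          exact setLIntegral_mono' Metric.isClosed_closedBall.measurableSet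
            fun y hy => by gcongr; exact hle y hy
  calc _ ≤ lam * ∑' b : u, ∫⁻ x in Metric.closedBall b.1.1 (5 * 2 ^ b.1.2), φ x := by
        gcongr
        exact (lintegral_mono_set hsub).trans (lintegral_iUnion_le _ _)
    _ = ∑' b : u, lam * ∫⁻ x in Metric.closedBall b.1.1 (5 * 2 ^ b.1.2), φ x :=
        ENNReal.tsum_mul_left.symm
    _ ≤ ∑' b : u, ENNReal.ofReal (8 ^ Module.finrank ℝ X) *
        ∫⁻ x in Metric.closedBall b.1.1 (2 ^ b.1.2), f x * dyadicMax φ x :=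
        ENNReal.tsum_le_tsum fun b => hball b.1 b.2
    _ = ENNReal.ofReal (8 ^ Module.finrank ℝ X) *
        ∫⁻ x in ⋃ b : u, Metric.closedBall b.1.1 (2 ^ b.1.2), f x * dyadicMax φ x := by
        rw [ENNReal.tsum_mul_left, lintegral_iUnion
          (fun b => Metric.isClosed_closedBall.measurableSet)]
        exact fun a b hab => hdis a.2 b.2 (Subtype.coe_injective.ne hab)
    _ ≤ _ := mul_le_mul_right (setLIntegral_le_lintegral _ _) _

/-- Weak type inequality for a pair of weights `(φ, Mφ)`. -/
lemma weak_type {f φ : X → ℝ≥0∞} (lam : ℝ≥0∞) :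
    lam * ∫⁻ x in {x | lam < dyadicMax f x}, φ x ≤
      ENNReal.ofReal (8 ^ Module.finrank ℝ X) * ∫⁻ x, f x * dyadicMax φ x := by
  set s : ℕ → Set X := fun N => {x | ∃ k ≤ (N : ℤ),
    lam * volume (Metric.closedBall x ((2 : ℝ) ^ k)) <
        ∫⁻ y in Metric.closedBall x ((2 : ℝ) ^ k), f y}
  have hs : {x | lam < dyadicMax f x} ⊆ ⋃ N, s N := by
    intro x hx
    obtain ⟨k, hk⟩ := lt_iSup_iff.1 (show lam < dyadicMax f x from hx)
    refine Set.mem_iUnion.2 ⟨k.toNat, k, Int.self_le_toNat k, ?_⟩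
    rw [mul_comm, ← div_eq_mul_inv] at hk
    rwa [ENNReal.lt_div_iff_mul_lt (Or.inl (volume_closedBall_ne_zero x (by positivity)))
      (Or.inl (volume_closedBall_ne_top x _))] at hk
  have hmono : Monotone s := fun M N hMN x ⟨k, hk, hx⟩ => ⟨k, hk.trans (by exact_mod_cast hMN), hx⟩
  calc _ ≤ lam * ∫⁻ x in ⋃ N, s N, φ x := by gcongr
    _ = ⨆ N, lam * ∫⁻ x in s N, φ x := by
        rw [setLIntegral_iUnion_of_directed _ hmono.directed_le, ENNReal.mul_iSup]
    _ ≤ _ := iSup_le fun N => weak_type_of_bddAbove_radius lam N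

end Maximal

/-! ### Integrals of powers and the layer-cake formula. -/

section PowerIntegrals

lemma lintegral_Ioo_rpow {s R : ℝ} (hs : 0 < s) (hR : 0 < R) :
    ∫⁻ l in Set.Ioo 0 R, ENNReal.ofReal (l ^ (s - 1)) = ENNReal.ofReal (R ^ s / s) := by
  have hint : IntervalIntegrable (fun l : ℝ => l ^ (s - 1)) volume 0 R :=
    intervalIntegral.intervalIntegrable_rpow' (by linarith)
  rw [intervalIntegrable_iff_integrableOn_Ioo_of_le hR.le] at hint
  rw [← ofReal_integral_eq_lintegral_ofReal hint, ← integral_Ioc_eq_integral_Ioo,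
    ← intervalIntegral.integral_of_le hR.le, integral_rpow (Or.inl (by linarith))]
  · simp [Real.zero_rpow hs.ne']
  · exact (ae_restrict_iff' measurableSet_Ioo).2
      (Filter.Eventually.of_forall fun l hl => Real.rpow_nonneg hl.1.le _)

lemma lintegral_Ioi_rpow {s R : ℝ} (hs : 0 < s) (hR : 0 < R) :
    ∫⁻ l in Set.Ioi R, ENNReal.ofReal (l ^ (-s - 1)) = ENNReal.ofReal (R ^ (-s) / s) := by
  rw [← ofReal_integral_eq_lintegral_ofReal (integrableOn_Ioi_rpow_of_lt (by linarith) hR),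
    integral_Ioi_rpow_of_lt (by linarith) hR]
  · congr 1
    rw [sub_add_cancel, neg_div_neg_eq]
  · exact (ae_restrict_iff' measurableSet_Ioi).2
      (Filter.Eventually.of_forall fun l hl => Real.rpow_nonneg (hR.trans hl).le _)

/-- Layer cake for a single value `a`, infinity included. Integrated in `x` with `a = g x`, it
converts level-set estimates into `L^s` estimates. -/
lemma lintegral_layer {s : ℝ} (hs : 0 < s) (a : ℝ≥0∞) :
    ∫⁻ l in Set.Ioi (0 : ℝ), {l | ENNReal.ofReal l < a}.indicator
      (fun l => ENNReal.ofReal (l ^ (s - 1))) l = a ^ s / ENNReal.ofReal s := by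
  have hm : MeasurableSet {l : ℝ | ENNReal.ofReal l < a} :=
    measurableSet_lt ENNReal.measurable_ofReal measurable_const
  rw [lintegral_indicator hm, Measure.restrict_restrict hm]
  have key : ∀ R : ℝ, 0 < R → ENNReal.ofReal R ^ s / ENNReal.ofReal s =
      ∫⁻ l in Set.Ioo 0 R, ENNReal.ofReal (l ^ (s - 1)) := fun R hR => by
    rw [lintegral_Ioo_rpow hs hR, ENNReal.ofReal_div_of_pos hs, ENNReal.ofReal_rpow_of_pos hR]
  rcases eq_or_ne a ∞ with rfl | ha
  · rw [ENNReal.top_rpow_of_pos hs, ENNReal.top_div_of_ne_top ENNReal.ofReal_ne_top]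
    refine ENNReal.eq_top_of_forall_nnreal_le fun c => ?_
    -- This is the `R` with `R ^ s / s = c + 1`, so the integral exceeds every `c`.
    have hpos : 0 < ((c + 1 : ℝ) * s) ^ (1 / s) := by positivity
    refine le_trans ?_ ((key _ hpos).trans_le (lintegral_mono_set fun l hl => ?_))
    · rw [ENNReal.ofReal_rpow_of_pos hpos, ← ENNReal.ofReal_div_of_pos hs,
        ← Real.rpow_mul (by positivity), one_div_mul_cancel hs.ne', Real.rpow_one,
        mul_div_cancel_right₀ _ hs.ne']
      rw [ENNReal.le_ofReal_iff_toReal_le ENNReal.coe_ne_top (by positivity)]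
      simp
    · exact ⟨ENNReal.ofReal_lt_top, hl.1⟩
  · lift a to ℝ≥0 using ha
    rcases eq_or_ne a 0 with rfl | h0
    · simp [ENNReal.zero_rpow_of_pos hs]
    · have hpos : (0 : ℝ) < a := by positivity
      have := key a hpos
      rw [ENNReal.ofReal_coe_nnreal] at this
      rw [this]
      congr 2
      ext l
      simp only [Set.mem_inter_iff, Set.mem_ofPred_eq, Set.mem_Ioi, Set.mem_Ioo]
      rw [and_comm]
      refine and_congr_right fun hl => ?_
      rw [ENNReal.ofReal_lt_coe_iff hl.le]

end PowerIntegrals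

/-! ### From weak type to the weighted strong type inequality. -/

section StrongType

variable {X : Type*} [NormedAddCommGroup X] [NormedSpace ℝ X] [FiniteDimensional ℝ X]
  [MeasureSpace X] [BorelSpace X] [(volume : Measure X).IsAddHaarMeasure]

/-- The weak type inequality with `f` cut off at the level `l / 2`. -/
lemma weak_type_cutoff {f φ : X → ℝ≥0∞} (hf : Measurable f) {l : ℝ} (hl : 0 < l) :
    ∫⁻ x in {x | ENNReal.ofReal l < dyadicMax f x}, φ x ≤
      ENNReal.ofReal (2 * 8 ^ Module.finrank ℝ X) * (ENNReal.ofReal l⁻¹ *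
        ∫⁻ x, {x | ENNReal.ofReal l < 2 * f x}.indicator (fun x => f x * dyadicMax φ x) x) := by
  set S := {x | ENNReal.ofReal l < 2 * f x} with hS
  have hSm : MeasurableSet S := measurableSet_lt measurable_const (hf.const_mul 2)
  have hhalf : ENNReal.ofReal l = ENNReal.ofReal (l / 2) + ENNReal.ofReal (l / 2) := by
    rw [← ENNReal.ofReal_add (by positivity) (by positivity), add_halves]
  have hsub : {x | ENNReal.ofReal l < dyadicMax f x} ⊆
      {x | ENNReal.ofReal (l / 2) < dyadicMax (S.indicator f) x} := by
    intro x hx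
    simp only [Set.mem_ofPred_eq] at hx ⊢
    -- Off `S` one has `f ≤ l / 2`, and the maximal function of a constant is at most that constant.
    have h1 : dyadicMax f x ≤ dyadicMax (S.indicator f) x + ENNReal.ofReal (l / 2) := by
      refine (dyadicMax_mono (g := fun y => S.indicator f y + ENNReal.ofReal (l / 2))
        (fun y => ?_) x).trans ((dyadicMax_add_le (hf.indicator hSm) x).trans
          (add_le_add le_rfl (dyadicMax_const_le _ x)))
      by_cases hy : y ∈ S
      · simp [hy]
      · simp only [hy, not_false_eq_true, Set.indicator_of_notMem, zero_add]
        simp only [hS, Set.mem_ofPred_eq, not_lt, hhalf, ← two_mul] at hy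
        exact (ENNReal.mul_le_mul_iff_right (by norm_num) (by norm_num)).1 hy
    by_contra! hcon
    exact absurd hx (not_lt.2 (h1.trans (hhalf ▸ add_le_add hcon le_rfl)))
  have hw := weak_type (f := S.indicator f) (φ := φ) (ENNReal.ofReal (l / 2))
  have hl2 : ENNReal.ofReal (l / 2) ≠ 0 := by simpa using hl
  calc _ ≤ ∫⁻ x in {x | ENNReal.ofReal (l / 2) < dyadicMax (S.indicator f) x}, φ x :=
        lintegral_mono_set hsub
    _ ≤ (ENNReal.ofReal (l / 2))⁻¹ * (ENNReal.ofReal (8 ^ Module.finrank ℝ X) *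
          ∫⁻ x, S.indicator f x * dyadicMax φ x) := by
        rw [mul_comm, ← div_eq_mul_inv, ENNReal.le_div_iff_mul_le (Or.inl hl2)
          (Or.inl ENNReal.ofReal_ne_top), mul_comm]
        exact hw
    _ = _ := by
        rw [← ENNReal.ofReal_inv_of_pos (by positivity), ← mul_assoc, ← mul_assoc,
          ← ENNReal.ofReal_mul (by positivity), ← ENNReal.ofReal_mul (by positivity)]
        congr 2
        · field_simp
        · ext x
          by_cases hx : x ∈ S <;> simp [hx]

/-- The constant in the weighted maximal inequality. -/
def maxConst (X : Type*) [NormedAddCommGroup X] [NormedSpace ℝ X] (q : ℝ) : ℝ≥0∞ :=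
  ENNReal.ofReal q * (ENNReal.ofReal (2 * 8 ^ Module.finrank ℝ X) *
    (2 ^ (q - 1) / ENNReal.ofReal (q - 1)))

lemma maxConst_ne_top {q : ℝ} (hq : 1 < q) : maxConst X q ≠ ∞ := by
  unfold maxConst
  refine ENNReal.mul_ne_top ENNReal.ofReal_ne_top (ENNReal.mul_ne_top ENNReal.ofReal_ne_top ?_)
  refine ENNReal.div_ne_top (ENNReal.rpow_ne_top_of_nonneg (by linarith) (by norm_num)) ?_
  simpa using hq

/-- The **Fefferman–Stein weighted inequality** `∫ (Mf)^q φ ≤ C ∫ f^q Mφ`. -/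
theorem lintegral_dyadicMax_rpow_mul_le {f φ : X → ℝ≥0∞} (hf : Measurable f) (hφ : Measurable φ)
    {q : ℝ} (hq : 1 < q) :
    ∫⁻ x, dyadicMax f x ^ q * φ x ≤ maxConst X q * ∫⁻ x, f x ^ q * dyadicMax φ x := by
  have hMf := measurable_dyadicMax hf
  have hMφ := measurable_dyadicMax hφ
  have hq0 : 0 < q := by linarith
  have hofq : ENNReal.ofReal q ≠ 0 := by simpa using hq0
  have hpow : ∀ s : ℝ, Measurable fun l : ℝ => ENNReal.ofReal (l ^ s) := fun s => by fun_prop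
  -- Layer cake combined with Tonelli. It is used with `g = dyadicMax f`, `s = q`, and then with `g
  -- = 2 f`, `s = q - 1`, the factor `1 / l` of the weak type bound having lowered the exponent. The
  -- second use requires `q > 1`.
  have layer : ∀ {s : ℝ}, 0 < s → ∀ {g h : X → ℝ≥0∞}, Measurable g → Measurable h →
      ∫⁻ l in Set.Ioi (0 : ℝ), ENNReal.ofReal (l ^ (s - 1)) *
        ∫⁻ x, {x | ENNReal.ofReal l < g x}.indicator h x =
      ∫⁻ x, g x ^ s / ENNReal.ofReal s * h x := by
    intro s hs g h hg hh
    have hmeas : Measurable (Function.uncurry fun (l : ℝ) (x : X) => ENNReal.ofReal (l ^ (s - 1)) *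
        {x | ENNReal.ofReal l < g x}.indicator h x) := by
      have : (Function.uncurry fun (l : ℝ) (x : X) => ENNReal.ofReal (l ^ (s - 1)) *
        {x | ENNReal.ofReal l < g x}.indicator h x) = {w : ℝ × X | ENNReal.ofReal w.1 < g w.2}.indicator
          (fun w => ENNReal.ofReal (w.1 ^ (s - 1)) * h w.2) := by
        ext ⟨l, x⟩
        simp [Function.uncurry, Set.indicator_apply]
      rw [this]
      exact Measurable.indicator (by fun_prop) (measurableSet_lt (by fun_prop) (by fun_prop))
    calc _ = ∫⁻ l in Set.Ioi (0 : ℝ), ∫⁻ x, ENNReal.ofReal (l ^ (s - 1)) *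
          {x | ENNReal.ofReal l < g x}.indicator h x := by
          refine lintegral_congr fun l => ?_
          rw [lintegral_const_mul]
          exact hh.indicator (measurableSet_lt measurable_const hg)
      _ = ∫⁻ x, ∫⁻ l in Set.Ioi (0 : ℝ), ENNReal.ofReal (l ^ (s - 1)) *
          {x | ENNReal.ofReal l < g x}.indicator h x := lintegral_lintegral_swap hmeas.aemeasurable
      _ = _ := by
          refine lintegral_congr fun x => ?_
          rw [← lintegral_layer hs, ← lintegral_mul_const]
          · refine lintegral_congr fun l => ?_
            simp [Set.indicator_apply]
          · exact (hpow _).indicator (measurableSet_lt ENNReal.measurable_ofReal measurable_const)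
  calc ∫⁻ x, dyadicMax f x ^ q * φ x
      = ENNReal.ofReal q * ∫⁻ x, dyadicMax f x ^ q / ENNReal.ofReal q * φ x := by
        rw [← lintegral_const_mul _ (by fun_prop)]
        refine lintegral_congr fun x => ?_
        rw [← mul_assoc, ENNReal.mul_div_cancel hofq ENNReal.ofReal_ne_top]
    _ = ENNReal.ofReal q * ∫⁻ l in Set.Ioi (0 : ℝ), ENNReal.ofReal (l ^ (q - 1)) *
        ∫⁻ x, {x | ENNReal.ofReal l < dyadicMax f x}.indicator φ x := by
        rw [layer hq0 hMf hφ]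
    _ ≤ ENNReal.ofReal q * ∫⁻ l in Set.Ioi (0 : ℝ), ENNReal.ofReal (2 * 8 ^ Module.finrank ℝ X) *
        (ENNReal.ofReal (l ^ (q - 1 - 1)) *
        ∫⁻ x, {x | ENNReal.ofReal l < 2 * f x}.indicator (fun x => f x * dyadicMax φ x) x) := by
        gcongr ENNReal.ofReal q * ?_
        refine setLIntegral_mono' measurableSet_Ioi fun l (hl : 0 < l) => ?_
        rw [lintegral_indicator (measurableSet_lt measurable_const hMf)]
        refine (mul_le_mul_right (weak_type_cutoff hf hl) _).trans_eq ?_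
        have : ENNReal.ofReal (l ^ (q - 1 - 1)) =
            ENNReal.ofReal (l ^ (q - 1)) * ENNReal.ofReal l⁻¹ := by
          rw [← ENNReal.ofReal_mul (by positivity), Real.rpow_sub_one hl.ne', div_eq_mul_inv]
        rw [this]
        ring
    _ = ENNReal.ofReal q * (ENNReal.ofReal (2 * 8 ^ Module.finrank ℝ X) *
        ∫⁻ x, (2 * f x) ^ (q - 1) / ENNReal.ofReal (q - 1) * (f x * dyadicMax φ x)) := by
        rw [lintegral_const_mul', layer (by linarith) (by fun_prop) (by fun_prop)]
        exact ENNReal.ofReal_ne_top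
    _ = _ := by
        unfold maxConst
        rw [mul_assoc, mul_assoc,
          ← lintegral_const_mul (2 ^ (q - 1) / ENNReal.ofReal (q - 1)) (by fun_prop)]
        congr 2
        refine lintegral_congr fun x => ?_
        have h1 : f x ^ q = f x ^ (q - 1) * f x := by
          conv_rhs => rw [← ENNReal.rpow_one (f x), ← ENNReal.rpow_mul, mul_comm,
            ← ENNReal.rpow_add_of_nonneg _ _ (by linarith) (by linarith)]
          ring_nf
        rw [h1, ENNReal.mul_rpow_of_nonneg _ _ (by linarith), div_eq_mul_inv, div_eq_mul_inv]
        ring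

theorem lintegral_dyadicMax_rpow_le {f : X → ℝ≥0∞} (hf : Measurable f) {q : ℝ} (hq : 1 < q) :
    ∫⁻ x, dyadicMax f x ^ q ≤ maxConst X q * ∫⁻ x, f x ^ q := by
  have h := lintegral_dyadicMax_rpow_mul_le hf (measurable_const (a := (1 : ℝ≥0∞))) hq
  simp only [mul_one] at h
  refine h.trans ?_
  gcongr with x
  exact (mul_le_mul_right (dyadicMax_const_le 1 x) _).trans_eq (mul_one _)

end StrongType

/-! ### Minkowski's inequality for series and the converse of Hölder's inequality. -/

section Lebesgue

variable {α : Type*} [MeasurableSpace α] {μ : Measure α}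

/-- Minkowski's inequality for countable sums. -/
lemma lintegral_tsum_rpow_le {p : ℝ} (hp : 1 ≤ p) {g : ℕ → α → ℝ≥0∞}
    (hg : ∀ n, Measurable (g n)) :
    (∫⁻ x, (∑' n, g n x) ^ p ∂μ) ^ (1 / p) ≤ ∑' n, (∫⁻ x, g n x ^ p ∂μ) ^ (1 / p) := by
  have hp0 : 0 < p := by linarith
  have hfin : ∀ N : ℕ, (∫⁻ x, (∑ n ∈ Finset.range N, g n x) ^ p ∂μ) ^ (1 / p) ≤
      ∑ n ∈ Finset.range N, (∫⁻ x, g n x ^ p ∂μ) ^ (1 / p) := by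
    intro N
    induction N with
    | zero => simp [ENNReal.zero_rpow_of_pos hp0, ENNReal.zero_rpow_of_pos (inv_pos.2 hp0)]
    | succ N ih =>
      simp_rw [Finset.sum_range_succ]
      refine le_trans ?_ (add_le_add ih le_rfl)
      exact ENNReal.lintegral_Lp_add_le (f := fun x => ∑ n ∈ Finset.range N, g n x)
        (Finset.measurable_fun_sum _ fun n _ => hg n).aemeasurable (hg N).aemeasurable hp
  have h1 : ∀ x, (∑' n, g n x) ^ p = ⨆ N, (∑ n ∈ Finset.range N, g n x) ^ p := fun x => by
    rw [ENNReal.tsum_eq_iSup_nat]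
    exact (ENNReal.orderIsoRpow p hp0).map_iSup _
  simp_rw [h1]
  rw [lintegral_iSup]
  · rw [show (⨆ N, ∫⁻ x, (∑ n ∈ Finset.range N, g n x) ^ p ∂μ) ^ (1 / p) =
      ⨆ N, (∫⁻ x, (∑ n ∈ Finset.range N, g n x) ^ p ∂μ) ^ (1 / p) from
      (ENNReal.orderIsoRpow (1 / p) (by positivity)).map_iSup _]
    exact iSup_le fun N => (hfin N).trans (ENNReal.sum_le_tsum _)
  · exact fun N => (Finset.measurable_fun_sum _ fun n _ => hg n).pow_const p
  · intro M N hMN x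
    exact ENNReal.rpow_le_rpow (Finset.sum_le_sum_of_subset (Finset.range_mono hMN)) hp0.le

/-- A converse of Hölder's inequality. -/
lemma lintegral_rpow_le_of_forall_mul [SigmaFinite μ] {s s' : ℝ} (hs : s.HolderConjugate s')
    {G : α → ℝ≥0∞} (hG : Measurable G) (K : ℝ≥0∞)
    (h : ∀ φ : α → ℝ≥0∞, Measurable φ →
      ∫⁻ x, G x * φ x ∂μ ≤ K * (∫⁻ x, φ x ^ s' ∂μ) ^ (1 / s')) :
    ∫⁻ x, G x ^ s ∂μ ≤ K ^ s := by
  have hs0 : 0 < s := hs.pos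
  set S := spanningSets μ
  -- Truncating in height and in support makes `∫ g ^ s` finite, so that a power of it can be
  -- cancelled below; monotone convergence removes the truncation.
  set g : ℕ → α → ℝ≥0∞ := fun n => (S n).indicator fun x => min (G x) n with hgdef
  have hgm : ∀ n, Measurable (g n) := fun n =>
    (hG.min measurable_const).indicator (measurableSet_spanningSets μ n)
  have hgG : ∀ n x, g n x ≤ G x := fun n x =>
    (Set.indicator_le_self' (fun _ _ => zero_le) x).trans (min_le_left _ _)
  have hmono : Monotone g := by
    intro m n hmn x
    by_cases hx : x ∈ S m
    · have hx' : x ∈ S n := monotone_spanningSets μ hmn hx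
      simp only [hgdef, hx, hx', Set.indicator_of_mem]
      exact min_le_min le_rfl (by exact_mod_cast hmn)
    · simp [hgdef, hx]
  have hsup : ∀ x, ⨆ n, g n x = G x := by
    intro x
    refine le_antisymm (iSup_le fun n => hgG n x) (le_of_forall_lt fun c hc => ?_)
    obtain ⟨n, hn⟩ := ENNReal.exists_nat_gt (ne_top_of_lt hc)
    obtain ⟨m, hm⟩ := Set.mem_iUnion.1 ((iUnion_spanningSets μ).symm ▸ Set.mem_univ x)
    refine lt_iSup_iff.2 ⟨max m n, ?_⟩
    have : x ∈ S (max m n) := monotone_spanningSets μ (le_max_left m n) hm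
    simp only [hgdef, this, Set.indicator_of_mem]
    exact lt_min hc (hn.trans_le (by exact_mod_cast le_max_right m n))
  have hsup' : ∀ x, G x ^ s = ⨆ n, g n x ^ s := fun x => by
    rw [← hsup x]
    exact (ENNReal.orderIsoRpow s hs0).map_iSup _
  simp_rw [hsup']
  rw [lintegral_iSup (fun n => (hgm n).pow_const s)
    (fun m n hmn x => ENNReal.rpow_le_rpow (hmono hmn x) hs0.le)]
  refine iSup_le fun n => ?_
  set T := ∫⁻ x, g n x ^ s ∂μ with hT
  have hTfin : T ≠ ∞ := by
    have : T ≤ ∫⁻ x in S n, (n : ℝ≥0∞) ^ s ∂μ := by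
      rw [← lintegral_indicator (measurableSet_spanningSets μ n)]
      refine lintegral_mono fun x => ?_
      by_cases hx : x ∈ S n
      · have hx' : x ∈ spanningSets μ n := hx
        simp only [hgdef, hx, hx', Set.indicator_of_mem]
        exact ENNReal.rpow_le_rpow (min_le_right _ _) hs0.le
      · simp [hgdef, hx, ENNReal.zero_rpow_of_pos hs0]
    refine ne_top_of_le_ne_top ?_ this
    rw [setLIntegral_const]
    exact ENNReal.mul_ne_top (ENNReal.rpow_ne_top_of_nonneg hs0.le (ENNReal.natCast_ne_top n))
      (measure_spanningSets_lt_top μ n).ne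
  have hs1 : 0 < s - 1 := by linarith [hs.lt]
  have hle : T ≤ K * T ^ (1 / s') := by
    -- The extremal test function: its power `s'` is again `g n ^ s`.
    have h1 := h (fun x => g n x ^ (s - 1)) ((hgm n).pow_const _)
    have h2 : ∀ x, (g n x ^ (s - 1)) ^ s' = g n x ^ s := fun x => by
      rw [← ENNReal.rpow_mul, hs.sub_one_mul_conj]
    simp_rw [h2] at h1
    refine le_trans (lintegral_mono fun x => ?_) h1
    calc g n x ^ s = g n x ^ (1 : ℝ) * g n x ^ (s - 1) := by
          rw [← ENNReal.rpow_add_of_nonneg _ _ zero_le_one hs1.le]; ring_nf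
      _ ≤ G x * g n x ^ (s - 1) := by
          rw [ENNReal.rpow_one]; gcongr; exact hgG n x
  rcases eq_or_ne T 0 with h0 | h0
  · rw [h0]; exact zero_le
  · have hsum : 1 / s + 1 / s' = 1 := by
      have := hs.inv_add_inv_eq_one
      simpa [one_div] using this
    have hc0 : T ^ (1 / s') ≠ 0 := by
      simp [ENNReal.rpow_eq_zero_iff, h0, hTfin]
    have hct : T ^ (1 / s') ≠ ∞ :=
      ENNReal.rpow_ne_top_of_nonneg (by have := hs.symm.pos; positivity) hTfin
    have h3 : T ^ (1 / s) * T ^ (1 / s') ≤ K * T ^ (1 / s') := by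
      rw [← ENNReal.rpow_add _ _ h0 hTfin, hsum, ENNReal.rpow_one]
      exact hle
    have h4 : T ^ (1 / s) ≤ K := (ENNReal.mul_le_mul_iff_left hc0 hct).1 h3
    calc T = (T ^ (1 / s)) ^ s := by
          rw [← ENNReal.rpow_mul, one_div_mul_cancel hs0.ne', ENNReal.rpow_one]
      _ ≤ K ^ s := ENNReal.rpow_le_rpow h4 hs0.le

end Lebesgue

/-! ### `A₁` majorants and log-convexity of the maximal function. -/

section RubioDeFrancia

variable {X : Type*} [NormedAddCommGroup X] [NormedSpace ℝ X] [FiniteDimensional ℝ X]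
  [MeasureSpace X] [BorelSpace X] [(volume : Measure X).IsAddHaarMeasure]

lemma measurable_dyadicMax_iterate {F : X → ℝ≥0∞} (hF : Measurable F) (n : ℕ) :
    Measurable (dyadicMax^[n] F) := by
  induction n with
  | zero => exact hF
  | succ n ih => rw [Function.iterate_succ_apply']; exact measurable_dyadicMax ih

/-- The **Rubio de Francia algorithm**: every function is majorized by an `A₁` weight of
comparable `L^p` norm. -/
lemma exists_majorant {p : ℝ} (hp : 1 < p) :
    ∃ A : ℝ≥0, ∀ F : X → ℝ≥0∞, Measurable F → ∃ u : X → ℝ≥0∞, Measurable u ∧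
      (∀ x, F x ≤ u x) ∧ (∀ x, dyadicMax u x ≤ A * u x) ∧
      ∫⁻ x, u x ^ p ≤ 2 ^ p * ∫⁻ x, F x ^ p := by
  have hp0 : 0 < p := by linarith
  -- Since `B ≥ 1` and `1 / p ≤ 1`, `B` dominates `maxConst X p ^ (1 / p)` and so bounds the maximal
  -- operator on `L^p`.
  set B : ℝ≥0 := max 1 (maxConst X p).toNNReal with hB
  have hB1 : 1 ≤ B := le_max_left _ _
  have hB0 : (B : ℝ≥0∞) ≠ 0 := by
    have : B ≠ 0 := (zero_lt_one.trans_le hB1).ne'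
    simpa using this
  have hM : ∀ F : X → ℝ≥0∞, Measurable F →
      (∫⁻ x, dyadicMax F x ^ p) ^ (1 / p) ≤ B * (∫⁻ x, F x ^ p) ^ (1 / p) := by
    intro F hF
    refine (ENNReal.rpow_le_rpow (lintegral_dyadicMax_rpow_le hF hp) (by positivity)).trans ?_
    rw [ENNReal.mul_rpow_of_nonneg _ _ (by positivity)]
    gcongr
    have h1 : maxConst X p ≤ B := by
      rw [← ENNReal.coe_toNNReal (maxConst_ne_top (X := X) hp)]
      exact_mod_cast le_max_right _ _
    calc maxConst X p ^ (1 / p) ≤ (B : ℝ≥0∞) ^ (1 / p) :=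
          ENNReal.rpow_le_rpow h1 (by positivity)
      _ ≤ (B : ℝ≥0∞) ^ (1 : ℝ) := by
          refine ENNReal.rpow_le_rpow_of_exponent_le (by exact_mod_cast hB1) ?_
          rw [div_le_one hp0]; exact hp.le
      _ = B := ENNReal.rpow_one _
  refine ⟨2 * B, fun F hF => ?_⟩
  have hmeas := measurable_dyadicMax_iterate hF
  set c : ℝ≥0∞ := (2 * B)⁻¹ with hc
  have h2B0 : (2 * B : ℝ≥0∞) ≠ 0 := mul_ne_zero two_ne_zero hB0
  have h2Bt : (2 * B : ℝ≥0∞) ≠ ∞ := ENNReal.mul_ne_top (by norm_num) ENNReal.coe_ne_top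
  -- The majorant is `u = ∑ (2B)^(-n) M^n F`. Its zeroth term is `F`; applying `M` shifts the series
  -- at the cost of a factor `2B`; its `L^p` norm is at most `∑ 2^(-n) = 2` times that of `F`.
  refine ⟨fun x => ∑' n : ℕ, c ^ n * dyadicMax^[n] F x,
    Measurable.tsum fun n => (hmeas n).const_mul _, fun x => ?_, fun x => ?_, ?_⟩
  · refine le_trans ?_ (ENNReal.le_tsum 0)
    simp
  · refine (dyadicMax_tsum_le (fun n => (hmeas n).const_mul _) x).trans ?_
    have h1 : ∀ n : ℕ, dyadicMax (fun y => c ^ n * dyadicMax^[n] F y) x =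
        (2 * B) * (c ^ (n + 1) * dyadicMax^[n + 1] F x) := fun n => by
      rw [dyadicMax_const_mul (hmeas n), Function.iterate_succ_apply', ← mul_assoc, pow_succ',
        ← mul_assoc, hc, ENNReal.mul_inv_cancel h2B0 h2Bt, one_mul]
    simp_rw [h1]
    rw [ENNReal.tsum_mul_left]
    push_cast
    refine mul_le_mul_right ?_ _
    exact ENNReal.tsum_comp_le_tsum_of_injective (add_left_injective 1)
      (fun n => c ^ n * dyadicMax^[n] F x)
  · have hiter : ∀ n : ℕ, (∫⁻ x, dyadicMax^[n] F x ^ p) ^ (1 / p) ≤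
        B ^ n * (∫⁻ x, F x ^ p) ^ (1 / p) := by
      intro n
      induction n with
      | zero => simp
      | succ n ih =>
        rw [Function.iterate_succ_apply']
        refine (hM _ (hmeas n)).trans ?_
        rw [pow_succ', mul_assoc]
        gcongr
    have hterm : ∀ n : ℕ, (∫⁻ x, (c ^ n * dyadicMax^[n] F x) ^ p) ^ (1 / p) ≤
        2⁻¹ ^ n * (∫⁻ x, F x ^ p) ^ (1 / p) := by
      intro n
      simp_rw [ENNReal.mul_rpow_of_nonneg _ _ hp0.le]
      rw [lintegral_const_mul _ ((hmeas n).pow_const p),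
        ENNReal.mul_rpow_of_nonneg _ _ (by positivity), ← ENNReal.rpow_mul,
        mul_one_div_cancel hp0.ne', ENNReal.rpow_one]
      calc _ ≤ c ^ n * (B ^ n * (∫⁻ x, F x ^ p) ^ (1 / p)) := by gcongr; exact hiter n
        _ = _ := by
          rw [← mul_assoc, ← mul_pow, hc, ENNReal.mul_inv (by simp) (by simp), mul_assoc,
            ENNReal.inv_mul_cancel hB0 ENNReal.coe_ne_top, mul_one]
    have htot : (∫⁻ x, (∑' n : ℕ, c ^ n * dyadicMax^[n] F x) ^ p) ^ (1 / p) ≤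
        2 * (∫⁻ x, F x ^ p) ^ (1 / p) := by
      refine (lintegral_tsum_rpow_le hp.le fun n => (hmeas n).const_mul _).trans ?_
      refine (ENNReal.tsum_le_tsum hterm).trans ?_
      rw [ENNReal.tsum_mul_right, ENNReal.tsum_geometric, ENNReal.one_sub_inv_two, inv_inv]
    have := ENNReal.rpow_le_rpow htot hp0.le
    rwa [ENNReal.mul_rpow_of_nonneg _ _ hp0.le, ← ENNReal.rpow_mul, ← ENNReal.rpow_mul,
      one_div_mul_cancel hp0.ne', ENNReal.rpow_one, ENNReal.rpow_one] at this

/-- Hölder's inequality for the maximal function. -/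
lemma dyadicMax_le_rpow_mul_rpow {f g h : X → ℝ≥0∞} (hg : Measurable g) (hh : Measurable h)
    {θ : ℝ} (h0 : 0 ≤ θ) (h1 : θ ≤ 1) (hf : ∀ᵐ x, f x ≤ g x ^ θ * h x ^ (1 - θ)) (x : X) :
    dyadicMax f x ≤ dyadicMax g x ^ θ * dyadicMax h x ^ (1 - θ) := by
  refine iSup_le fun k => ?_
  set B := Metric.closedBall x ((2 : ℝ) ^ k)
  have hV0 : (volume B)⁻¹ ≠ 0 := ENNReal.inv_ne_zero.2 (volume_closedBall_ne_top x _)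
  have hVt : (volume B)⁻¹ ≠ ∞ :=
    ENNReal.inv_ne_top.2 (volume_closedBall_ne_zero x (by positivity))
  calc (volume B)⁻¹ * ∫⁻ y in B, f y
      ≤ (volume B)⁻¹ * ∫⁻ y in B, g y ^ θ * h y ^ (1 - θ) := by
        exact mul_le_mul_right (lintegral_mono_ae (ae_restrict_of_ae hf)) _
    _ ≤ (volume B)⁻¹ * ((∫⁻ y in B, g y) ^ θ * (∫⁻ y in B, h y) ^ (1 - θ)) := by
        gcongr
        exact ENNReal.lintegral_mul_norm_pow_le hg.aemeasurable hh.aemeasurable h0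
          (by linarith) (by ring)
    _ = ((volume B)⁻¹ * ∫⁻ y in B, g y) ^ θ * ((volume B)⁻¹ * ∫⁻ y in B, h y) ^ (1 - θ) := by
        rw [ENNReal.mul_rpow_of_nonneg _ _ h0, ENNReal.mul_rpow_of_nonneg _ _ (by linarith)]
        have : (volume B)⁻¹ = (volume B)⁻¹ ^ θ * (volume B)⁻¹ ^ (1 - θ) := by
          rw [← ENNReal.rpow_add _ _ hV0 hVt]; simp
        conv_lhs => rw [this]
        ring
    _ ≤ _ := by
        gcongr
        · exact le_iSup (fun k : ℤ => (volume (Metric.closedBall x ((2 : ℝ) ^ k)))⁻¹ *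
            ∫⁻ y in Metric.closedBall x ((2 : ℝ) ^ k), g y) k
        · exact le_iSup (fun k : ℤ => (volume (Metric.closedBall x ((2 : ℝ) ^ k)))⁻¹ *
            ∫⁻ y in Metric.closedBall x ((2 : ℝ) ^ k), h y) k

/-- The dyadic balls around the single point `x` exhaust the space. This serves to show that an `A₁`
majorant of a nontrivial function vanishes nowhere, so its negative powers are finite. -/
lemma lintegral_eq_zero_of_dyadicMax_eq_zero {f : X → ℝ≥0∞} {x : X} (h : dyadicMax f x = 0) :
    ∫⁻ y, f y = 0 := by
  have h1 : ∀ n : ℕ, ∫⁻ y in Metric.closedBall x ((2 : ℝ) ^ n), f y = 0 := fun n => by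
    have := lintegral_closedBall_two_zpow_le f x n
    rw [h, mul_zero] at this
    simpa using this
  have h2 : (⋃ n : ℕ, Metric.closedBall x ((2 : ℝ) ^ n)) = Set.univ := by
    refine Set.eq_univ_of_forall fun y => Set.mem_iUnion.2 ?_
    obtain ⟨n, hn⟩ := pow_unbounded_of_one_lt (dist y x) (one_lt_two : (1 : ℝ) < 2)
    exact ⟨n, hn.le⟩
  rw [← setLIntegral_univ, ← h2, ← nonpos_iff_eq_zero]
  refine (lintegral_iUnion_le _ _).trans ?_
  simp [h1]

end RubioDeFrancia

/-! ### The maximal inequality for `L^q`-valued functions. -/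

section VectorValued

variable {X : Type*} [NormedAddCommGroup X] [NormedSpace ℝ X] [FiniteDimensional ℝ X]
  [MeasureSpace X] [BorelSpace X] [(volume : Measure X).IsAddHaarMeasure]
  {Y : Type*} [MeasurableSpace Y] {ν : Measure Y} [SFinite ν]

/-- The maximal function in the first variable. -/
def partialMax (f : X × Y → ℝ≥0∞) (w : X × Y) : ℝ≥0∞ := dyadicMax (fun x => f (x, w.2)) w.1

lemma measurable_partialMax {f : X × Y → ℝ≥0∞} (hf : Measurable f) : Measurable (partialMax f) :=
  measurable_dyadicMax_uncurry hf

lemma lintegral_lintegral_swap_mul {f : X × Y → ℝ≥0∞} {φ : X → ℝ≥0∞} (hf : Measurable f)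
    (hφ : Measurable φ) :
    ∫⁻ x, (∫⁻ y, f (x, y) ∂ν) * φ x = ∫⁻ y, (∫⁻ x, f (x, y) * φ x) ∂ν := by
  rw [← lintegral_lintegral_swap (f := fun x y => f (x, y) * φ x)
    (by unfold Function.uncurry; fun_prop)]
  refine lintegral_congr fun x => ?_
  rw [lintegral_mul_const _ (by fun_prop)]

/-- The weight does not depend on `y`, so Tonelli reduces this to the scalar weighted inequality on
each slice. -/
lemma lintegral_partialMax_mul_le {f : X × Y → ℝ≥0∞} (hf : Measurable f) {φ : X → ℝ≥0∞}
    (hφ : Measurable φ) {q : ℝ} (hq : 1 < q) :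
    ∫⁻ x, (∫⁻ y, partialMax f (x, y) ^ q ∂ν) * φ x ≤
      maxConst X q * ∫⁻ x, (∫⁻ y, f (x, y) ^ q ∂ν) * dyadicMax φ x := by
  have hMf := measurable_partialMax hf
  rw [lintegral_lintegral_swap_mul (f := fun w => partialMax f w ^ q) (hMf.pow_const q) hφ,
    lintegral_lintegral_swap_mul (f := fun w => f w ^ q) (hf.pow_const q)
      (measurable_dyadicMax hφ), ← lintegral_const_mul' _ _ (maxConst_ne_top hq)]
  refine lintegral_mono fun y => ?_
  exact lintegral_dyadicMax_rpow_mul_le (f := fun x => f (x, y)) (by fun_prop) hφ hq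

lemma lintegral_partialMax_le {f : X × Y → ℝ≥0∞} (hf : Measurable f) {q : ℝ} (hq : 1 < q) :
    ∫⁻ x, ∫⁻ y, partialMax f (x, y) ^ q ∂ν ≤
      maxConst X q * ∫⁻ x, ∫⁻ y, f (x, y) ^ q ∂ν := by
  have h := lintegral_partialMax_mul_le (ν := ν) hf (measurable_const (a := (1 : ℝ≥0∞))) hq
  simp only [mul_one] at h
  refine h.trans ?_
  gcongr with x
  exact (mul_le_mul_right (dyadicMax_const_le 1 x) _).trans_eq (mul_one _)

/-- With `s = p / q > 1`, the inner integral is tested against `φ ∈ L^s'`. The weighted inequality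
moves the maximal operator from `f` to `φ`, where it is bounded on `L^s'`. -/
lemma lintegral_partialMax_le_of_lt {p q : ℝ} (hq : 1 < q) (hqp : q < p) :
    ∃ C : ℝ≥0, ∀ f : X × Y → ℝ≥0∞, Measurable f →
      ∫⁻ x, (∫⁻ y, partialMax f (x, y) ^ q ∂ν) ^ (p / q) ≤
        C * ∫⁻ x, (∫⁻ y, f (x, y) ^ q ∂ν) ^ (p / q) := by
  have hq0 : 0 < q := by linarith
  set s := p / q with hs
  have hs1 : 1 < s := by rwa [hs, one_lt_div hq0]
  have hs0 : 0 < s := by linarith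
  have hconj : s.HolderConjugate (Real.conjExponent s) := Real.HolderConjugate.conjExponent hs1
  set s' := Real.conjExponent s
  have hs1' : 1 < s' := hconj.symm.lt
  have hs0' : 0 < s' := by linarith
  set K := maxConst X q * maxConst X s' ^ (1 / s') with hK
  have hKt : K ≠ ∞ := ENNReal.mul_ne_top (maxConst_ne_top hq)
    (ENNReal.rpow_ne_top_of_nonneg (by positivity) (maxConst_ne_top hs1'))
  refine ⟨(K ^ s).toNNReal, fun f hf => ?_⟩
  rw [ENNReal.coe_toNNReal (ENNReal.rpow_ne_top_of_nonneg hs0.le hKt)]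
  have hG : Measurable fun x => ∫⁻ y, partialMax f (x, y) ^ q ∂ν :=
    ((measurable_partialMax hf).pow_const q).lintegral_prod_right'
  have hH : Measurable fun x => ∫⁻ y, f (x, y) ^ q ∂ν :=
    (hf.pow_const q).lintegral_prod_right'
  refine (lintegral_rpow_le_of_forall_mul hconj hG
    (K * (∫⁻ x, (∫⁻ y, f (x, y) ^ q ∂ν) ^ s) ^ (1 / s)) fun φ hφ => ?_).trans_eq ?_
  · have hMφ := measurable_dyadicMax hφ
    calc _ ≤ maxConst X q * ∫⁻ x, (∫⁻ y, f (x, y) ^ q ∂ν) * dyadicMax φ x :=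
          lintegral_partialMax_mul_le hf hφ hq
      _ ≤ maxConst X q * ((∫⁻ x, (∫⁻ y, f (x, y) ^ q ∂ν) ^ s) ^ (1 / s) *
            (∫⁻ x, dyadicMax φ x ^ s') ^ (1 / s')) := by
          refine mul_le_mul_right ?_ _
          exact ENNReal.lintegral_mul_le_Lp_mul_Lq _ hconj hH.aemeasurable hMφ.aemeasurable
      _ ≤ maxConst X q * ((∫⁻ x, (∫⁻ y, f (x, y) ^ q ∂ν) ^ s) ^ (1 / s) *
            (maxConst X s' * ∫⁻ x, φ x ^ s') ^ (1 / s')) := by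
          gcongr
          exact lintegral_dyadicMax_rpow_le hφ hs1'
      _ = _ := by
          rw [ENNReal.mul_rpow_of_nonneg _ _ (by positivity), hK]
          ring
  · rw [ENNReal.mul_rpow_of_nonneg _ _ hs0.le, ← ENNReal.rpow_mul _ (1 / s),
      one_div_mul_cancel hs0.ne', ENNReal.rpow_one]

/-- Duality is not available as `p / q < 1`. Let `F x` be the `L^q` norm of the slice `f (x, ·)` and
`u ≥ F` its `A₁` majorant in `L^p`. Write `f = h^θ u^(1-θ)` with `θ = p / q`. Hölder gives `Mf ≤
(Mh)^θ (A u)^(1-θ)`, and `h` is handled by the diagonal case in `L^p`: its slice integral is `F^q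
u^(p-q) ≤ F^p` because `F ≤ u`. -/
lemma lintegral_partialMax_le_of_gt {p q : ℝ} (hp : 1 < p) (hpq : p < q) :
    ∃ C : ℝ≥0, ∀ f : X × Y → ℝ≥0∞, Measurable f →
      ∫⁻ x, (∫⁻ y, partialMax f (x, y) ^ q ∂ν) ^ (p / q) ≤
        C * ∫⁻ x, (∫⁻ y, f (x, y) ^ q ∂ν) ^ (p / q) := by
  have hp0 : 0 < p := by linarith
  have hq0 : 0 < q := by linarith
  have hq1 : 1 < q := by linarith
  set θ := p / q with hθ
  have hθ0 : 0 < θ := by positivity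
  have hθ1 : θ < 1 := by rwa [hθ, div_lt_one hq0]
  have hθq : θ * q = p := by rw [hθ]; field_simp
  obtain ⟨A, hA⟩ := exists_majorant (X := X) hp
  set K : ℝ≥0∞ := maxConst X p ^ θ * (A ^ p * 2 ^ p) ^ (1 - θ) with hK
  have hKt : K ≠ ∞ := by
    refine ENNReal.mul_ne_top (ENNReal.rpow_ne_top_of_nonneg hθ0.le (maxConst_ne_top hp))
      (ENNReal.rpow_ne_top_of_nonneg (by linarith) (ENNReal.mul_ne_top ?_ ?_)) <;>
    exact ENNReal.rpow_ne_top_of_nonneg hp0.le (by simp)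
  -- Adding `1` keeps the constant nonzero, so that the bound is trivial when the right-hand
  -- integral is infinite.
  refine ⟨(K + 1).toNNReal, fun f hf => ?_⟩
  rw [ENNReal.coe_toNNReal (by simp [hKt])]
  have hMf := measurable_partialMax hf
  have hH : Measurable fun x => ∫⁻ y, f (x, y) ^ q ∂ν :=
    (hf.pow_const q).lintegral_prod_right'
  set H : X → ℝ≥0∞ := fun x => ∫⁻ y, f (x, y) ^ q ∂ν with hHdef
  set G : X → ℝ≥0∞ := fun x => ∫⁻ y, partialMax f (x, y) ^ q ∂ν with hGdef
  have hG : Measurable G := (hMf.pow_const q).lintegral_prod_right'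
  change ∫⁻ x, G x ^ θ ≤ (K + 1) * ∫⁻ x, H x ^ θ
  set I := ∫⁻ x, H x ^ θ with hI
  rcases eq_or_ne I ∞ with hItop | hItop
  · rw [hItop, ENNReal.mul_top (by simp)]; exact le_top
  rcases eq_or_ne I 0 with hI0 | hI0
  · have h1 : ∀ᵐ x, H x = 0 := by
      rw [hI, lintegral_eq_zero_iff (hH.pow_const θ)] at hI0
      filter_upwards [hI0] with x hx
      simpa [ENNReal.rpow_eq_zero_iff, hθ0, hθ0.le, hθ0.not_gt] using hx
    have h2 : ∫⁻ x, G x = 0 := by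
      refine nonpos_iff_eq_zero.1 ((lintegral_partialMax_le hf hq1).trans ?_)
      rw [lintegral_congr_ae (g := fun _ => 0) h1]
      simp
    rw [lintegral_eq_zero_iff hG] at h2
    rw [lintegral_congr_ae (g := fun _ => 0)]
    · simp
    · filter_upwards [h2] with x hx
      rw [hx]
      exact ENNReal.zero_rpow_of_pos hθ0
  set F : X → ℝ≥0∞ := fun x => H x ^ (1 / q) with hF
  have hFp : ∀ x, F x ^ p = H x ^ θ := fun x => by
    rw [hF, ← ENNReal.rpow_mul, hθ]; congr 1; field_simp
  have hFq : ∀ x, F x ^ q = H x := fun x => by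
    rw [hF, ← ENNReal.rpow_mul, one_div_mul_cancel hq0.ne', ENNReal.rpow_one]
  obtain ⟨u, hu, hFu, hMu, hup⟩ := hA F (hH.pow_const _)
  simp_rw [hFp] at hup
  change _ ≤ 2 ^ p * I at hup
  have hupt : ∫⁻ x, u x ^ p ≠ ∞ := ne_top_of_le_ne_top
    (ENNReal.mul_ne_top (ENNReal.rpow_ne_top_of_nonneg hp0.le (by simp)) hItop) hup
  have hufin : ∀ᵐ x, u x ≠ ∞ := by
    filter_upwards [ae_lt_top (hu.pow_const p) hupt] with x hx h
    simp [h, ENNReal.top_rpow_of_pos hp0] at hx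
  have hupos : ∀ x, u x ≠ 0 := by
    intro x hx
    have h1 : dyadicMax u x = 0 := by
      have := hMu x
      rw [hx, mul_zero] at this
      exact nonpos_iff_eq_zero.1 this
    have h2 := lintegral_eq_zero_of_dyadicMax_eq_zero h1
    rw [lintegral_eq_zero_iff hu] at h2
    refine hI0 ?_
    rw [hI, lintegral_congr_ae (g := fun _ => 0)]
    · simp
    · filter_upwards [h2] with y hy
      have h3 : F y = 0 := nonpos_iff_eq_zero.1 ((hFu y).trans_eq hy)
      rw [← hFp, h3]
      exact ENNReal.zero_rpow_of_pos hp0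
  set h : X × Y → ℝ≥0∞ := fun w => f w ^ (1 / θ) * u w.1 ^ (-((1 - θ) / θ)) with hh
  have hhm : Measurable h := by fun_prop
  have hMh := measurable_partialMax hhm
  have hpt : ∀ x y, partialMax f (x, y) ≤ partialMax h (x, y) ^ θ * (A * u x) ^ (1 - θ) := by
    intro x y
    refine (dyadicMax_le_rpow_mul_rpow (f := fun x => f (x, y)) (g := fun x => h (x, y)) (h := u)
      (by fun_prop) hu hθ0.le hθ1.le ?_ x).trans ?_
    · filter_upwards [hufin] with x hx
      simp only [hh]
      rw [ENNReal.mul_rpow_of_nonneg _ _ hθ0.le, ← ENNReal.rpow_mul, ← ENNReal.rpow_mul,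
        one_div_mul_cancel hθ0.ne', ENNReal.rpow_one, mul_assoc,
        ← ENNReal.rpow_add _ _ (hupos x) hx]
      have : -((1 - θ) / θ) * θ + (1 - θ) = 0 := by field_simp; ring
      rw [this, ENNReal.rpow_zero, mul_one]
    · refine mul_le_mul_right (ENNReal.rpow_le_rpow (hMu x) (by linarith)) _
  set L : X → ℝ≥0∞ := fun x => ∫⁻ y, partialMax h (x, y) ^ p ∂ν with hL
  have hLm : Measurable L := (hMh.pow_const p).lintegral_prod_right'
  have hGle : ∀ x, G x ^ θ ≤ L x ^ θ * ((A * u x) ^ p) ^ (1 - θ) := by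
    intro x
    have h1 : G x ≤ L x * (A * u x) ^ (q - p) := by
      rw [hL, ← lintegral_mul_const _ (by fun_prop)]
      refine lintegral_mono fun y => ?_
      refine (ENNReal.rpow_le_rpow (hpt x y) hq0.le).trans_eq ?_
      rw [ENNReal.mul_rpow_of_nonneg _ _ hq0.le, ← ENNReal.rpow_mul, ← ENNReal.rpow_mul, hθq]
      congr 2
      linear_combination -hθq
    refine (ENNReal.rpow_le_rpow h1 hθ0.le).trans_eq ?_
    rw [ENNReal.mul_rpow_of_nonneg _ _ hθ0.le, ← ENNReal.rpow_mul, ← ENNReal.rpow_mul]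
    congr 2
    linear_combination hθq
  have hLle : ∫⁻ x, L x ≤ maxConst X p * I := by
    refine (lintegral_partialMax_le hhm hp).trans (mul_le_mul_right ?_ _)
    refine lintegral_mono_ae ?_
    filter_upwards [hufin] with x hx
    have h1 : ∀ y, h (x, y) ^ p = f (x, y) ^ q * u x ^ (-(q - p)) := fun y => by
      simp only [hh]
      rw [ENNReal.mul_rpow_of_nonneg _ _ hp0.le, ← ENNReal.rpow_mul, ← ENNReal.rpow_mul]
      congr 2
      · rw [hθ]; field_simp
      · rw [hθ]; field_simp
    simp_rw [h1]
    rw [lintegral_mul_const _ (by fun_prop)]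
    change H x * _ ≤ _
    rw [← hFp, ← hFq]
    rcases eq_or_ne (F x) 0 with h0 | h0
    · rw [h0, ENNReal.zero_rpow_of_pos hq0, zero_mul]; exact zero_le
    · have hFt : F x ≠ ∞ := ne_top_of_le_ne_top hx (hFu x)
      calc F x ^ q * u x ^ (-(q - p)) ≤ F x ^ q * F x ^ (-(q - p)) := by
            rw [ENNReal.rpow_neg, ENNReal.rpow_neg]
            gcongr
            exact hFu x
        _ = F x ^ p := by
            rw [← ENNReal.rpow_add _ _ h0 hFt]; congr 1; ring
  calc ∫⁻ x, G x ^ θ ≤ ∫⁻ x, L x ^ θ * ((A * u x) ^ p) ^ (1 - θ) := lintegral_mono hGle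
    _ ≤ (∫⁻ x, L x) ^ θ * (∫⁻ x, (A * u x) ^ p) ^ (1 - θ) :=
        ENNReal.lintegral_mul_norm_pow_le hLm.aemeasurable
          ((hu.const_mul _).pow_const p).aemeasurable hθ0.le (by linarith) (by ring)
    _ ≤ (maxConst X p * I) ^ θ * (A ^ p * 2 ^ p * I) ^ (1 - θ) := by
        have h1 : ∫⁻ x, (A * u x) ^ p ≤ A ^ p * 2 ^ p * I := by
          simp_rw [ENNReal.mul_rpow_of_nonneg _ _ hp0.le]
          rw [lintegral_const_mul _ (hu.pow_const p), mul_assoc]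
          gcongr
        exact mul_le_mul' (ENNReal.rpow_le_rpow hLle hθ0.le)
          (ENNReal.rpow_le_rpow h1 (by linarith))
    _ = K * I := by
        rw [ENNReal.mul_rpow_of_nonneg _ _ hθ0.le, ENNReal.mul_rpow_of_nonneg _ I (by linarith)]
        have : I = I ^ θ * I ^ (1 - θ) := by
          rw [← ENNReal.rpow_add _ _ hI0 hItop]; simp
        conv_rhs => rw [this]
        rw [hK]
        ring
    _ ≤ _ := by gcongr; exact le_self_add

/-- The **Fefferman–Stein vector-valued maximal inequality** for `L^q`-valued functions. -/
theorem exists_lintegral_partialMax_le (X : Type*) [NormedAddCommGroup X] [NormedSpace ℝ X]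
    [FiniteDimensional ℝ X] [MeasureSpace X] [BorelSpace X]
    [(volume : Measure X).IsAddHaarMeasure] {Y : Type*} [MeasurableSpace Y] (ν : Measure Y)
    [SFinite ν] {p q : ℝ} (hp : 1 < p) (hq : 1 < q) :
    ∃ C : ℝ≥0, ∀ f : X × Y → ℝ≥0∞, Measurable f →
      ∫⁻ x, (∫⁻ y, partialMax f (x, y) ^ q ∂ν) ^ (p / q) ≤
        C * ∫⁻ x, (∫⁻ y, f (x, y) ^ q ∂ν) ^ (p / q) := by
  rcases lt_trichotomy p q with h | rfl | h
  · exact lintegral_partialMax_le_of_gt hp h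
  · refine ⟨(maxConst X p).toNNReal, fun f hf => ?_⟩
    rw [ENNReal.coe_toNNReal (maxConst_ne_top hp)]
    simp only [div_self (show p ≠ 0 by linarith), ENNReal.rpow_one]
    exact lintegral_partialMax_le hf hp
  · exact lintegral_partialMax_le_of_lt hq h

end VectorValued

/-! ### Mixed norms `L^p(L^q)`. -/

section MixedNorm

variable {X Y : Type*} [MeasurableSpace X] [MeasurableSpace Y]

/-- The norm of `L^p(μ; L^q(ν))`. -/
def mixedNorm (μ : Measure X) (ν : Measure Y) (p q : ℝ) (f : X × Y → ℝ≥0∞) : ℝ≥0∞ :=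
  (∫⁻ x, (∫⁻ y, f (x, y) ^ q ∂ν) ^ (p / q) ∂μ) ^ (1 / p)

variable {μ : Measure X} {ν : Measure Y} {p q : ℝ} {f g : X × Y → ℝ≥0∞}

lemma mixedNorm_mono_on (hp : 0 < p) (hq : 0 < q) {A : Set X} {B : Set Y} (hA : MeasurableSet A)
    (hB : MeasurableSet B) (h : ∀ x ∈ A, ∀ y ∈ B, f (x, y) ≤ g (x, y)) :
    mixedNorm (μ.restrict A) (ν.restrict B) p q f ≤
      mixedNorm (μ.restrict A) (ν.restrict B) p q g := by
  refine ENNReal.rpow_le_rpow (setLIntegral_mono' hA fun x hx => ?_) (by positivity)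
  refine ENNReal.rpow_le_rpow (setLIntegral_mono' hB fun y hy => ?_) (by positivity)
  exact ENNReal.rpow_le_rpow (h x hx y hy) hq.le

lemma mixedNorm_restrict_le (hp : 0 < p) (hq : 0 < q) (A : Set X) (B : Set Y) :
    mixedNorm (μ.restrict A) (ν.restrict B) p q f ≤ mixedNorm μ ν p q f := by
  refine ENNReal.rpow_le_rpow ((setLIntegral_le_lintegral _ _).trans
    (lintegral_mono fun x => ?_)) (by positivity)
  exact ENNReal.rpow_le_rpow (setLIntegral_le_lintegral _ _) (by positivity)

lemma mixedNorm_congr_ae [SFinite ν] (h : f =ᵐ[μ.prod ν] g) :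
    mixedNorm μ ν p q f = mixedNorm μ ν p q g := by
  unfold mixedNorm
  congr 1
  refine lintegral_congr_ae ?_
  filter_upwards [Measure.ae_ae_of_ae_prod h] with x hx
  congr 1
  refine lintegral_congr_ae ?_
  filter_upwards [hx] with y hy
  rw [hy]

lemma mixedNorm_add_le [SFinite ν] (hp : 1 ≤ p) (hq : 1 ≤ q) (hf : Measurable f)
    (hg : Measurable g) :
    mixedNorm μ ν p q (fun w => f w + g w) ≤ mixedNorm μ ν p q f + mixedNorm μ ν p q g := by
  have hp0 : 0 < p := by linarith
  have hq0 : 0 < q := by linarith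
  have hpow : ∀ h : X × Y → ℝ≥0∞, mixedNorm μ ν p q h =
      (∫⁻ x, ((∫⁻ y, h (x, y) ^ q ∂ν) ^ (1 / q)) ^ p ∂μ) ^ (1 / p) := fun h => by
    unfold mixedNorm
    congr 2
    ext x
    rw [← ENNReal.rpow_mul]
    congr 1
    ring
  rw [hpow, hpow, hpow]
  refine le_trans ?_ (ENNReal.lintegral_Lp_add_le
    ((hf.pow_const q).lintegral_prod_right'.pow_const _).aemeasurable
    ((hg.pow_const q).lintegral_prod_right'.pow_const _).aemeasurable hp)
  refine ENNReal.rpow_le_rpow (lintegral_mono fun x => ENNReal.rpow_le_rpow ?_ hp0.le)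
    (by positivity)
  exact ENNReal.lintegral_Lp_add_le (f := fun y => f (x, y)) (g := fun y => g (x, y))
    (by fun_prop) (by fun_prop) hq

lemma mixedNorm_const_mul (hp : 0 < p) (hq : 0 < q) {c : ℝ≥0∞} (hc : c ≠ ∞) :
    mixedNorm μ ν p q (fun w => c * f w) = c * mixedNorm μ ν p q f := by
  unfold mixedNorm
  simp_rw [ENNReal.mul_rpow_of_nonneg _ _ hq.le]
  have h1 : ∀ x, (∫⁻ y, c ^ q * f (x, y) ^ q ∂ν) ^ (p / q) =
      c ^ p * (∫⁻ y, f (x, y) ^ q ∂ν) ^ (p / q) := fun x => by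
    rw [lintegral_const_mul' _ _ (ENNReal.rpow_ne_top_of_nonneg hq.le hc),
      ENNReal.mul_rpow_of_nonneg _ _ (by positivity), ← ENNReal.rpow_mul,
      mul_div_cancel₀ _ hq.ne']
  simp_rw [h1]
  rw [lintegral_const_mul' _ _ (ENNReal.rpow_ne_top_of_nonneg hp.le hc),
    ENNReal.mul_rpow_of_nonneg _ _ (by positivity), ← ENNReal.rpow_mul, mul_one_div_cancel hp.ne',
    ENNReal.rpow_one]

lemma mixedNorm_const (hp : 0 < p) (hq : 0 < q) (c : ℝ≥0∞) :
    mixedNorm μ ν p q (fun _ => c) = c * (ν Set.univ ^ (1 / q) * μ Set.univ ^ (1 / p)) := by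
  unfold mixedNorm
  rw [lintegral_const, lintegral_const, ENNReal.mul_rpow_of_nonneg _ _ (by positivity),
    ENNReal.mul_rpow_of_nonneg _ _ (by positivity), ENNReal.mul_rpow_of_nonneg _ _ (by positivity),
    ← ENNReal.rpow_mul, ← ENNReal.rpow_mul, ← ENNReal.rpow_mul, mul_assoc]
  have h1 : q * (p / q * (1 / p)) = 1 := by field_simp
  have h2 : p / q * (1 / p) = 1 / q := by field_simp
  rw [h1, h2, ENNReal.rpow_one]

lemma mixedNorm_rpow {θ : ℝ} (hθ : 0 < θ) (hp : 0 < p) :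
    mixedNorm μ ν p q (fun w => f w ^ θ) = mixedNorm μ ν (θ * p) (θ * q) f ^ θ := by
  unfold mixedNorm
  simp_rw [← ENNReal.rpow_mul]
  rw [mul_div_mul_left _ _ hθ.ne']
  congr 1
  field_simp

lemma mixedNorm_indicator {A : Set X} {B : Set Y} (hA : MeasurableSet A) (hB : MeasurableSet B)
    (hp : 0 < p) (hq : 0 < q) :
    mixedNorm μ ν p q ((A ×ˢ B).indicator f) =
      mixedNorm (μ.restrict A) (ν.restrict B) p q f := by
  unfold mixedNorm
  rw [← lintegral_indicator hA]
  congr 2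
  ext x
  by_cases hx : x ∈ A
  · rw [Set.indicator_of_mem hx, ← lintegral_indicator hB]
    congr 2
    ext y
    by_cases hy : y ∈ B <;> simp [hx, hy, ENNReal.zero_rpow_of_pos hq]
  · simp [hx, ENNReal.zero_rpow_of_pos hq, ENNReal.zero_rpow_of_pos (div_pos hp hq)]

lemma lintegral_le_measure_univ_rpow_mul {Z : Type*} [MeasurableSpace Z] (ρ : Measure Z) {s : ℝ}
    (hs : 1 < s) {g : Z → ℝ≥0∞} (hg : Measurable g) :
    ∫⁻ z, g z ∂ρ ≤ ρ Set.univ ^ (1 - 1 / s) * (∫⁻ z, g z ^ s ∂ρ) ^ (1 / s) := by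
  have hs0 : 0 < s := by linarith
  have hs1 : 1 / s ≤ 1 := by rw [div_le_one hs0]; exact hs.le
  have := ENNReal.lintegral_mul_norm_pow_le (μ := ρ) (f := fun _ => (1 : ℝ≥0∞))
    (g := fun z => g z ^ s) aemeasurable_const (hg.pow_const s).aemeasurable
    (p := 1 - 1 / s) (q := 1 / s) (by linarith) (by positivity) (by ring)
  simp only [ENNReal.one_rpow, one_mul, lintegral_const, ← ENNReal.rpow_mul,
    mul_one_div_cancel hs0.ne', ENNReal.rpow_one] at this
  exact this

lemma lintegral_le_mixedNorm [SFinite ν] (hp : 1 < p) (hq : 1 < q) (hf : Measurable f) :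
    ∫⁻ w, f w ∂(μ.prod ν) ≤
      μ Set.univ ^ (1 - 1 / p) * ν Set.univ ^ (1 - 1 / q) * mixedNorm μ ν p q f := by
  have hp0 : 0 < p := by linarith
  have hq0 : 0 < q := by linarith
  have hm : Measurable fun x => (∫⁻ y, f (x, y) ^ q ∂ν) ^ (1 / q) :=
    (hf.pow_const q).lintegral_prod_right'.pow_const _
  rw [lintegral_prod _ hf.aemeasurable]
  calc _ ≤ ∫⁻ x, ν Set.univ ^ (1 - 1 / q) * (∫⁻ y, f (x, y) ^ q ∂ν) ^ (1 / q) ∂μ :=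
        lintegral_mono fun x => lintegral_le_measure_univ_rpow_mul ν hq (by fun_prop)
    _ = ν Set.univ ^ (1 - 1 / q) * ∫⁻ x, (∫⁻ y, f (x, y) ^ q ∂ν) ^ (1 / q) ∂μ :=
        lintegral_const_mul _ hm
    _ ≤ ν Set.univ ^ (1 - 1 / q) * (μ Set.univ ^ (1 - 1 / p) *
          (∫⁻ x, ((∫⁻ y, f (x, y) ^ q ∂ν) ^ (1 / q)) ^ p ∂μ) ^ (1 / p)) := by
        gcongr
        exact lintegral_le_measure_univ_rpow_mul μ hp hm
    _ = _ := by
        simp_rw [← ENNReal.rpow_mul]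
        rw [one_div_mul_eq_div, mixedNorm]
        ring

end MixedNorm

/-! ### The iterated maximal function on a product. -/

section IteratedMaximal

variable {X Y : Type*} [NormedAddCommGroup X] [NormedSpace ℝ X] [FiniteDimensional ℝ X]
  [MeasureSpace X] [BorelSpace X] [(volume : Measure X).IsAddHaarMeasure]
  [NormedAddCommGroup Y] [NormedSpace ℝ Y] [FiniteDimensional ℝ Y]
  [MeasureSpace Y] [BorelSpace Y] [(volume : Measure Y).IsAddHaarMeasure]

/-- The maximal function in the second variable followed by that in the first. -/
def iterMax (f : X × Y → ℝ≥0∞) : X × Y → ℝ≥0∞ :=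
  partialMax fun w => dyadicMax (fun y => f (w.1, y)) w.2

lemma measurable_dyadicMax_snd {f : X × Y → ℝ≥0∞} (hf : Measurable f) :
    Measurable fun w : X × Y => dyadicMax (fun y => f (w.1, y)) w.2 := by
  have h1 : Measurable fun w : Y × X => f (w.2, w.1) := by fun_prop
  have h2 := (measurable_dyadicMax_uncurry h1).comp (measurable_swap (α := X) (β := Y))
  simp only [Function.comp_def, Prod.fst_swap, Prod.snd_swap] at h2
  exact h2

lemma measurable_iterMax {f : X × Y → ℝ≥0∞} (hf : Measurable f) : Measurable (iterMax f) :=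
  measurable_partialMax (measurable_dyadicMax_snd hf)

/-- The inner operator acts on scalar functions of `y` for fixed `x`. The outer one acts on
`L^q(Y)`-valued functions of `x`, which is where the vector-valued inequality is needed. -/
lemma exists_mixedNorm_iterMax_le (X Y : Type*) [NormedAddCommGroup X] [NormedSpace ℝ X]
    [FiniteDimensional ℝ X] [MeasureSpace X] [BorelSpace X]
    [(volume : Measure X).IsAddHaarMeasure] [NormedAddCommGroup Y] [NormedSpace ℝ Y]
    [FiniteDimensional ℝ Y] [MeasureSpace Y] [BorelSpace Y]
    [(volume : Measure Y).IsAddHaarMeasure] {p q : ℝ} (hp : 1 < p) (hq : 1 < q) :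
    ∃ C : ℝ≥0, ∀ f : X × Y → ℝ≥0∞, Measurable f →
      mixedNorm volume volume p q (iterMax f) ≤ C * mixedNorm volume volume p q f := by
  have hp0 : 0 < p := by linarith
  have hq0 : 0 < q := by linarith
  obtain ⟨C, hC⟩ := exists_lintegral_partialMax_le X (volume : Measure Y) hp hq
  set K : ℝ≥0∞ := C * maxConst Y q ^ (p / q)
  have hDt : maxConst Y q ^ (p / q) ≠ ∞ :=
    ENNReal.rpow_ne_top_of_nonneg (by positivity) (maxConst_ne_top hq)
  have hKt : K ^ (1 / p) ≠ ∞ := ENNReal.rpow_ne_top_of_nonneg (by positivity)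
    (ENNReal.mul_ne_top ENNReal.coe_ne_top hDt)
  refine ⟨(K ^ (1 / p)).toNNReal, fun f hf => ?_⟩
  rw [ENNReal.coe_toNNReal hKt]
  unfold mixedNorm
  rw [← ENNReal.mul_rpow_of_nonneg _ _ (by positivity)]
  refine ENNReal.rpow_le_rpow ?_ (by positivity)
  refine (hC _ (measurable_dyadicMax_snd hf)).trans ?_
  rw [mul_assoc, ← lintegral_const_mul' _ _ hDt]
  gcongr with x
  rw [← ENNReal.mul_rpow_of_nonneg _ _ (by positivity)]
  exact ENNReal.rpow_le_rpow (lintegral_dyadicMax_rpow_le (f := fun y => f (x, y)) (by fun_prop) hq)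
    (by positivity)

lemma lintegral_prod_ball_le {f : X × Y → ℝ≥0∞} (hf : Measurable f) (x : X) (y : Y) {r s : ℝ}
    (hr : 0 < r) (hs : 0 < s) :
    ∫⁻ w in Metric.ball x r ×ˢ Metric.ball y s, f w ≤
      ENNReal.ofReal (2 ^ Module.finrank ℝ X) * ENNReal.ofReal (2 ^ Module.finrank ℝ Y) *
      (volume (Metric.ball x r) * volume (Metric.ball y s)) * iterMax f (x, y) := by
  have hvX : volume (Metric.closedBall x r) = volume (Metric.ball x r) := by
    rw [Measure.addHaar_ball_of_pos _ _ hr, Measure.addHaar_closedBall _ _ hr.le]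
  have hvY : volume (Metric.closedBall y s) = volume (Metric.ball y s) := by
    rw [Measure.addHaar_ball_of_pos _ _ hs, Measure.addHaar_closedBall _ _ hs.le]
  rw [Measure.volume_eq_prod, ← Measure.prod_restrict, lintegral_prod _ hf.aemeasurable]
  have hc : ENNReal.ofReal (2 ^ Module.finrank ℝ Y) * volume (Metric.ball y s) ≠ ∞ := by
    rw [← hvY]
    exact ENNReal.mul_ne_top ENNReal.ofReal_ne_top (volume_closedBall_ne_top y s)
  calc _ ≤ ∫⁻ x' in Metric.closedBall x r, ENNReal.ofReal (2 ^ Module.finrank ℝ Y) *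
          volume (Metric.ball y s) * dyadicMax (fun y => f (x', y)) y := by
        refine (lintegral_mono_set Metric.ball_subset_closedBall).trans
          (lintegral_mono fun x' => ?_)
        refine (lintegral_mono_set Metric.ball_subset_closedBall).trans ?_
        rw [← hvY]
        exact lintegral_closedBall_le (fun y => f (x', y)) y hs
    _ ≤ ENNReal.ofReal (2 ^ Module.finrank ℝ Y) * volume (Metric.ball y s) *
          (ENNReal.ofReal (2 ^ Module.finrank ℝ X) * volume (Metric.ball x r) *
            iterMax f (x, y)) := by
        rw [lintegral_const_mul' _ _ hc, ← hvX]
        refine mul_le_mul_right ?_ _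
        exact lintegral_closedBall_le (fun x' => dyadicMax (fun y => f (x', y)) y) x hr
    _ = _ := by ring

end IteratedMaximal

/-! ### Anisotropic Morrey spaces: the maximal function and Hedberg's method. -/

section Morrey

variable {X Y : Type*} [NormedAddCommGroup X] [NormedSpace ℝ X] [FiniteDimensional ℝ X]
  [MeasureSpace X] [BorelSpace X] [(volume : Measure X).IsAddHaarMeasure]
  [NormedAddCommGroup Y] [NormedSpace ℝ Y] [FiniteDimensional ℝ Y]
  [MeasureSpace Y] [BorelSpace Y] [(volume : Measure Y).IsAddHaarMeasure]

/-- The anisotropic cylinder with radii `r^a` and `r^b`. -/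
def cyl (a b : ℕ) (r : ℝ) (z : X × Y) : Set (X × Y) :=
  Metric.ball z.1 (r ^ a) ×ˢ Metric.ball z.2 (r ^ b)

/-- The homogeneous dimension of `X × Y` for the dilations `(r^a, r^b)`. -/
def hdim (X Y : Type*) [NormedAddCommGroup X] [NormedSpace ℝ X] [NormedAddCommGroup Y]
    [NormedSpace ℝ Y] (a b : ℕ) : ℝ :=
  a * Module.finrank ℝ X + b * Module.finrank ℝ Y

/-- The exponent `β - a dim X / p - b dim Y / q`. -/
def morreyExp (X Y : Type*) [NormedAddCommGroup X] [NormedSpace ℝ X] [NormedAddCommGroup Y]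
    [NormedSpace ℝ Y] (a b : ℕ) (p q β : ℝ) : ℝ :=
  β - a * Module.finrank ℝ X / p - b * Module.finrank ℝ Y / q

/-- The `L^p(L^q)` norm over a cylinder. -/
def localNorm (a b : ℕ) (p q : ℝ) (f : X × Y → ℝ≥0∞) (r : ℝ) (z : X × Y) : ℝ≥0∞ :=
  mixedNorm (volume.restrict (Metric.ball z.1 (r ^ a)))
    (volume.restrict (Metric.ball z.2 (r ^ b))) p q f

/-- The anisotropic mixed-norm Morrey norm. -/
def morreyNorm (a b : ℕ) (p q β : ℝ) (f : X × Y → ℝ≥0∞) : ℝ≥0∞ :=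
  ⨆ (r : ℝ) (_ : 0 < r) (z : X × Y),
    ENNReal.ofReal (r ^ morreyExp X Y a b p q β) * localNorm a b p q f r z

/-- The maximal function over cylinders. -/
def cylMax (a b : ℕ) (f : X × Y → ℝ≥0∞) (z : X × Y) : ℝ≥0∞ :=
  ⨆ (r : ℝ) (_ : 0 < r), ENNReal.ofReal (r ^ (-hdim X Y a b)) * ∫⁻ w in cyl a b r z, f w

/-- The fractional integral, written as an average over all scales of integrals over cylinders. -/
def cylPotential (a b : ℕ) (α : ℝ) (f : X × Y → ℝ≥0∞) (z : X × Y) : ℝ≥0∞ :=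
  ∫⁻ l in Set.Ioi (0 : ℝ), ENNReal.ofReal (l ^ (α - hdim X Y a b - 1)) * ∫⁻ w in cyl a b l z, f w

/-- The constant in Hölder's inequality on cylinders. -/
def cylConst (X Y : Type*) [NormedAddCommGroup X] [MeasureSpace X] [NormedAddCommGroup Y]
    [MeasureSpace Y] (p q : ℝ) : ℝ≥0∞ :=
  volume (Metric.ball (0 : X) 1) ^ (1 - 1 / p) * volume (Metric.ball (0 : Y) 1) ^ (1 - 1 / q)

variable {a b : ℕ} {p q β : ℝ} {f g : X × Y → ℝ≥0∞}

lemma volume_ball_pow (x : X) {r : ℝ} (hr : 0 < r) (a : ℕ) :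
    volume (Metric.ball x (r ^ a)) = ENNReal.ofReal (r ^ ((a : ℝ) * Module.finrank ℝ X)) *
      volume (Metric.ball (0 : X) 1) := by
  rw [Measure.addHaar_ball_of_pos _ x (by positivity), ← pow_mul, ← Real.rpow_natCast]
  push_cast
  rfl

lemma volume_ball_pow_rpow (x : X) {r : ℝ} (hr : 0 < r) (a : ℕ) {s : ℝ} (hs : 0 ≤ s) :
    volume (Metric.ball x (r ^ a)) ^ s = ENNReal.ofReal (r ^ ((a : ℝ) * Module.finrank ℝ X * s)) *
      volume (Metric.ball (0 : X) 1) ^ s := by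
  rw [volume_ball_pow x hr, ENNReal.mul_rpow_of_nonneg _ _ hs,
    ENNReal.ofReal_rpow_of_pos (by positivity), ← Real.rpow_mul hr.le]

lemma ofReal_rpow_mul_ofReal_rpow {r : ℝ} (hr : 0 < r) (s t : ℝ) :
    ENNReal.ofReal (r ^ s) * ENNReal.ofReal (r ^ t) = ENNReal.ofReal (r ^ (s + t)) := by
  rw [← ENNReal.ofReal_mul (by positivity), Real.rpow_add hr]

lemma volume_ball_zero_one_ne_top : volume (Metric.ball (0 : X) 1) ≠ ∞ := measure_ball_lt_top.ne

lemma cylConst_ne_top (hp : 1 < p) (hq : 1 < q) : cylConst X Y p q ≠ ∞ := by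
  have h : ∀ {s : ℝ}, 1 < s → 0 ≤ 1 - 1 / s := fun {s} hs => by
    rw [sub_nonneg, div_le_one (by linarith)]; exact hs.le
  exact ENNReal.mul_ne_top (ENNReal.rpow_ne_top_of_nonneg (h hp) volume_ball_zero_one_ne_top)
    (ENNReal.rpow_ne_top_of_nonneg (h hq) volume_ball_zero_one_ne_top)

lemma localNorm_le {r : ℝ} (hr : 0 < r) (z : X × Y) :
    localNorm a b p q f r z ≤
      ENNReal.ofReal (r ^ (-morreyExp X Y a b p q β)) * morreyNorm a b p q β f := by
  have h : ENNReal.ofReal (r ^ morreyExp X Y a b p q β) * localNorm a b p q f r z ≤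
      morreyNorm a b p q β f := le_iSup₂_of_le r hr (le_iSup_of_le z le_rfl)
  calc _ = ENNReal.ofReal (r ^ (-morreyExp X Y a b p q β)) *
        (ENNReal.ofReal (r ^ morreyExp X Y a b p q β) * localNorm a b p q f r z) := by
        rw [← mul_assoc, ofReal_rpow_mul_ofReal_rpow hr]; simp
    _ ≤ _ := by gcongr

lemma morreyNorm_mono (hp : 0 < p) (hq : 0 < q) (h : ∀ w, f w ≤ g w) :
    morreyNorm a b p q β f ≤ morreyNorm a b p q β g := by
  unfold morreyNorm localNorm
  gcongr
  exact mixedNorm_mono_on hp hq measurableSet_ball measurableSet_ball fun x _ y _ => h (x, y)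

lemma morreyNorm_const_mul (hp : 0 < p) (hq : 0 < q) {c : ℝ≥0∞} (hc : c ≠ ∞) :
    morreyNorm a b p q β (fun w => c * f w) = c * morreyNorm a b p q β f := by
  unfold morreyNorm localNorm
  simp_rw [mixedNorm_const_mul hp hq hc, ENNReal.mul_iSup, mul_left_comm c]

lemma morreyNorm_congr_ae (h : f =ᵐ[volume] g) :
    morreyNorm a b p q β f = morreyNorm a b p q β g := by
  have : ∀ r (z : X × Y), localNorm a b p q f r z = localNorm a b p q g r z := fun r z => by
    refine mixedNorm_congr_ae ?_
    rw [Measure.prod_restrict]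
    exact ae_restrict_of_ae h
  simp_rw [morreyNorm, this]

/-- Hölder in both variables. The volume factors turn the Morrey exponent into `hdim - β`, so
averages at scale `r` decay like `r ^ (-β)`, whatever `p` and `q` are. -/
lemma lintegral_cyl_le (hp : 1 < p) (hq : 1 < q) (hf : Measurable f) {r : ℝ} (hr : 0 < r)
    (z : X × Y) :
    ∫⁻ w in cyl a b r z, f w ≤ cylConst X Y p q *
      (ENNReal.ofReal (r ^ (hdim X Y a b - β)) * morreyNorm a b p q β f) := by
  have h : ∀ {s : ℝ}, 1 < s → 0 ≤ 1 - 1 / s := fun {s} hs => by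
    rw [sub_nonneg, div_le_one (by linarith)]; exact hs.le
  rw [cyl, Measure.volume_eq_prod, ← Measure.prod_restrict]
  refine (lintegral_le_mixedNorm hp hq hf).trans ?_
  rw [Measure.restrict_apply_univ, Measure.restrict_apply_univ, volume_ball_pow_rpow _ hr a (h hp),
    volume_ball_pow_rpow _ hr b (h hq)]
  refine (mul_le_mul_right (localNorm_le (β := β) hr z) _).trans_eq ?_
  have : hdim X Y a b - β = (a : ℝ) * Module.finrank ℝ X * (1 - 1 / p) +
      (b : ℝ) * Module.finrank ℝ Y * (1 - 1 / q) + -morreyExp X Y a b p q β := by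
    unfold hdim morreyExp; ring
  rw [this, ← ofReal_rpow_mul_ofReal_rpow hr, ← ofReal_rpow_mul_ofReal_rpow hr, cylConst]
  ring

lemma measurableSet_cyl (r : ℝ) (z : X × Y) : MeasurableSet (cyl a b r z) :=
  measurableSet_ball.prod measurableSet_ball

lemma cyl_subset_cyl (ha : a ≠ 0) (hb : b ≠ 0) {r R : ℝ} (hR : 0 < R) (hr : R ≤ r)
    {z z₀ : X × Y} (hz : z ∈ cyl a b r z₀) : cyl a b R z ⊆ cyl a b (2 * r) z₀ := by
  -- Doubling `r` suffices as `2 ≤ 2 ^ c`; this fails for `c = 0`.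
  have hpow : ∀ {c : ℕ}, c ≠ 0 → R ^ c + r ^ c ≤ (2 * r) ^ c := fun {c} hc => by
    have h1 : R ^ c ≤ r ^ c := by gcongr
    have h2 : (2 : ℝ) ≤ 2 ^ c := le_self_pow₀ (by norm_num) hc
    have h3 : 0 ≤ r ^ c := pow_nonneg (hR.le.trans hr) c
    rw [mul_pow]
    nlinarith
  refine Set.prod_mono (Metric.ball_subset_ball' ?_) (Metric.ball_subset_ball' ?_)
  · have := hz.1; rw [Metric.mem_ball] at this; linarith [hpow ha]
  · have := hz.2; rw [Metric.mem_ball] at this; linarith [hpow hb]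

lemma lintegral_cyl_le_iterMax (hf : Measurable f) {r : ℝ} (hr : 0 < r) (z : X × Y) :
    ENNReal.ofReal (r ^ (-hdim X Y a b)) * ∫⁻ w in cyl a b r z, f w ≤
      ENNReal.ofReal (2 ^ Module.finrank ℝ X) * ENNReal.ofReal (2 ^ Module.finrank ℝ Y) *
      (volume (Metric.ball (0 : X) 1) * volume (Metric.ball (0 : Y) 1)) * iterMax f z := by
  refine (mul_le_mul_right (lintegral_prod_ball_le hf z.1 z.2 (by positivity) (by positivity))
    _).trans_eq ?_
  rw [volume_ball_pow _ hr, volume_ball_pow _ hr]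
  have h1 : ENNReal.ofReal (r ^ (-hdim X Y a b)) *
      (ENNReal.ofReal (r ^ ((a : ℝ) * Module.finrank ℝ X)) *
        ENNReal.ofReal (r ^ ((b : ℝ) * Module.finrank ℝ Y))) = 1 := by
    rw [ofReal_rpow_mul_ofReal_rpow hr, ofReal_rpow_mul_ofReal_rpow hr]
    simp [hdim]
  calc _ = (ENNReal.ofReal (r ^ (-hdim X Y a b)) *
      (ENNReal.ofReal (r ^ ((a : ℝ) * Module.finrank ℝ X)) *
        ENNReal.ofReal (r ^ ((b : ℝ) * Module.finrank ℝ Y)))) * (ENNReal.ofReal (2 ^ Module.finrank ℝ X) *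
          ENNReal.ofReal (2 ^ Module.finrank ℝ Y) *
      (volume (Metric.ball (0 : X) 1) * volume (Metric.ball (0 : Y) 1)) * iterMax f z) := by ring
    _ = _ := by rw [h1, one_mul]

/-- Scales up to `r` see only `f` on the doubled cylinder and go into the iterated maximal function;
larger scales are bounded by the decay in `lintegral_cyl_le`. -/
lemma cylMax_le_on_cyl (ha : a ≠ 0) (hb : b ≠ 0) (hp : 1 < p) (hq : 1 < q) (hβ : 0 ≤ β)
    (hf : Measurable f) {r : ℝ} (hr : 0 < r) {z z₀ : X × Y} (hz : z ∈ cyl a b r z₀) :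
    cylMax a b f z ≤
      ENNReal.ofReal (2 ^ Module.finrank ℝ X) * ENNReal.ofReal (2 ^ Module.finrank ℝ Y) *
      (volume (Metric.ball (0 : X) 1) * volume (Metric.ball (0 : Y) 1)) *
        iterMax ((cyl a b (2 * r) z₀).indicator f) z +
      cylConst X Y p q * (ENNReal.ofReal (r ^ (-β)) * morreyNorm a b p q β f) := by
  refine iSup₂_le fun R hR => ?_
  rcases le_or_gt R r with hRr | hRr
  · refine le_add_right ?_
    refine le_trans ?_ (lintegral_cyl_le_iterMax (a := a) (b := b)
      (hf.indicator (measurableSet_cyl _ _)) hR z)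
    refine mul_le_mul_right ?_ _
    refine setLIntegral_mono' (measurableSet_cyl _ _) fun w hw => ?_
    rw [Set.indicator_of_mem (cyl_subset_cyl ha hb hR hRr hz hw)]
  · refine le_add_left ?_
    refine (mul_le_mul_right (lintegral_cyl_le (β := β) hp hq hf hR z) _).trans ?_
    rw [mul_left_comm, ← mul_assoc (ENNReal.ofReal (R ^ _)), ofReal_rpow_mul_ofReal_rpow hR]
    gcongr
    rw [show -hdim X Y a b + (hdim X Y a b - β) = -β by ring]
    exact Real.rpow_le_rpow_of_nonpos hr hRr.le (by linarith)

/-- The maximal function over cylinders is bounded on Morrey spaces. -/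
theorem exists_morreyNorm_cylMax_le (X Y : Type*) [NormedAddCommGroup X] [NormedSpace ℝ X]
    [FiniteDimensional ℝ X] [MeasureSpace X] [BorelSpace X]
    [(volume : Measure X).IsAddHaarMeasure] [NormedAddCommGroup Y] [NormedSpace ℝ Y]
    [FiniteDimensional ℝ Y] [MeasureSpace Y] [BorelSpace Y]
    [(volume : Measure Y).IsAddHaarMeasure] {a b : ℕ} {p q β : ℝ} (ha : a ≠ 0) (hb : b ≠ 0)
    (hp : 1 < p) (hq : 1 < q) (hβ : 0 ≤ β) :
    ∃ C : ℝ≥0, ∀ f : X × Y → ℝ≥0∞, Measurable f →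
      morreyNorm a b p q β (cylMax a b f) ≤ C * morreyNorm a b p q β f := by
  have hp0 : 0 < p := by linarith
  have hq0 : 0 < q := by linarith
  obtain ⟨C, hC⟩ := exists_mixedNorm_iterMax_le X Y hp hq
  set D : ℝ≥0∞ := ENNReal.ofReal (2 ^ Module.finrank ℝ X) *
    ENNReal.ofReal (2 ^ Module.finrank ℝ Y) *
      (volume (Metric.ball (0 : X) 1) * volume (Metric.ball (0 : Y) 1)) with hD
  set κ := morreyExp X Y a b p q β with hκ
  have hDt : D ≠ ∞ := ENNReal.mul_ne_top (ENNReal.mul_ne_top ENNReal.ofReal_ne_top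
    ENNReal.ofReal_ne_top) (ENNReal.mul_ne_top volume_ball_zero_one_ne_top
      volume_ball_zero_one_ne_top)
  set V : ℝ≥0∞ := volume (Metric.ball (0 : Y) 1) ^ (1 / q) *
    volume (Metric.ball (0 : X) 1) ^ (1 / p) with hV
  have hVt : V ≠ ∞ := ENNReal.mul_ne_top
    (ENNReal.rpow_ne_top_of_nonneg (by positivity) volume_ball_zero_one_ne_top)
    (ENNReal.rpow_ne_top_of_nonneg (by positivity) volume_ball_zero_one_ne_top)
  -- The factor `2 ^ (-κ)` comes from measuring `f` on the cylinder of radius `2r`; `V` is the mixed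
  -- norm of the constant `1` on the unit cylinder.
  set K : ℝ≥0∞ := D * C * ENNReal.ofReal (2 ^ (-κ)) + cylConst X Y p q * V with hK
  have hKt : K ≠ ∞ := ENNReal.add_ne_top.2 ⟨ENNReal.mul_ne_top (ENNReal.mul_ne_top hDt
    ENNReal.coe_ne_top) ENNReal.ofReal_ne_top, ENNReal.mul_ne_top (cylConst_ne_top hp hq) hVt⟩
  refine ⟨K.toNNReal, fun f hf => ?_⟩
  rw [ENNReal.coe_toNNReal hKt]
  refine iSup₂_le fun r hr => iSup_le fun z => ?_
  set N := morreyNorm a b p q β f with hN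
  set f₁ := (cyl a b (2 * r) z).indicator f with hf₁
  have hf₁m : Measurable f₁ := hf.indicator (measurableSet_cyl _ _)
  have h1 : localNorm a b p q (cylMax a b f) r z ≤
      D * localNorm a b p q (iterMax f₁) r z +
        cylConst X Y p q * (ENNReal.ofReal (r ^ (-β)) * N) *
          (ENNReal.ofReal (r ^ (β - κ)) * V) := by
    refine (mixedNorm_mono_on hp0 hq0 measurableSet_ball measurableSet_ball
      (g := fun w => D * iterMax f₁ w + cylConst X Y p q * (ENNReal.ofReal (r ^ (-β)) * N))
      fun x hx y hy => cylMax_le_on_cyl ha hb hp hq hβ hf hr (z := (x, y)) (z₀ := z)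
        ⟨hx, hy⟩).trans ?_
    refine (mixedNorm_add_le hp.le hq.le ((measurable_iterMax hf₁m).const_mul D)
      measurable_const).trans (add_le_add ?_ ?_)
    · rw [mixedNorm_const_mul hp0 hq0 hDt, localNorm]
    · rw [mixedNorm_const hp0 hq0, Measure.restrict_apply_univ, Measure.restrict_apply_univ,
        volume_ball_pow_rpow _ hr a (by positivity), volume_ball_pow_rpow _ hr b (by positivity)]
      refine le_of_eq (congrArg _ ?_)
      have : β - κ = (a : ℝ) * Module.finrank ℝ X * (1 / p) +
          (b : ℝ) * Module.finrank ℝ Y * (1 / q) := by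
        rw [hκ, morreyExp]; ring
      rw [this, ← ofReal_rpow_mul_ofReal_rpow hr, hV]
      ring
  have h2 : localNorm a b p q (iterMax f₁) r z ≤
      C * (ENNReal.ofReal (2 ^ (-κ)) * ENNReal.ofReal (r ^ (-κ)) * N) := by
    refine (mixedNorm_restrict_le hp0 hq0 _ _).trans ((hC f₁ hf₁m).trans (mul_le_mul_right ?_ _))
    rw [hf₁, cyl, mixedNorm_indicator measurableSet_ball measurableSet_ball hp0 hq0]
    refine (localNorm_le (β := β) (by positivity) z).trans_eq ?_
    rw [Real.mul_rpow (by norm_num) hr.le, ENNReal.ofReal_mul (by positivity)]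
  have hcan : ENNReal.ofReal (r ^ κ) * ENNReal.ofReal (r ^ (-κ)) = 1 := by
    rw [ofReal_rpow_mul_ofReal_rpow hr]; simp
  have hcan' : ENNReal.ofReal (r ^ κ) * (ENNReal.ofReal (r ^ (-β)) *
      ENNReal.ofReal (r ^ (β - κ))) = 1 := by
    rw [ofReal_rpow_mul_ofReal_rpow hr, ofReal_rpow_mul_ofReal_rpow hr,
      show κ + (-β + (β - κ)) = 0 by ring]
    simp
  calc _ ≤ ENNReal.ofReal (r ^ κ) *
        (D * (C * (ENNReal.ofReal (2 ^ (-κ)) * ENNReal.ofReal (r ^ (-κ)) * N)) +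
        cylConst X Y p q * (ENNReal.ofReal (r ^ (-β)) * N) *
          (ENNReal.ofReal (r ^ (β - κ)) * V)) :=
        mul_le_mul_right (h1.trans (add_le_add (mul_le_mul_right h2 _) le_rfl)) _
    _ = D * C * ENNReal.ofReal (2 ^ (-κ)) * (ENNReal.ofReal (r ^ κ) * ENNReal.ofReal (r ^ (-κ))) * N
        + cylConst X Y p q * V * (ENNReal.ofReal (r ^ κ) * (ENNReal.ofReal (r ^ (-β)) *
      ENNReal.ofReal (r ^ (β - κ)))) * N := by ring
    _ = K * N := by rw [hcan, hcan', hK]; ring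

/-- Hedberg's splitting of the potential at radius `R`. -/
lemma cylPotential_le_add (hp : 1 < p) (hq : 1 < q) (hf : Measurable f) {α : ℝ} (hα : 0 < α)
    (hαβ : α < β) {R : ℝ} (hR : 0 < R) (z : X × Y) :
    cylPotential a b α f z ≤ ENNReal.ofReal (R ^ α / α) * cylMax a b f z +
      cylConst X Y p q * (ENNReal.ofReal (R ^ (α - β) / (β - α)) * morreyNorm a b p q β f) := by
  have hpow : ∀ s : ℝ, Measurable fun l : ℝ => ENNReal.ofReal (l ^ s) := fun s => by fun_prop
  rw [cylPotential, ← Set.Ioc_union_Ioi_eq_Ioi hR.le]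
  refine (lintegral_union_le _ _ _).trans (add_le_add ?_ ?_)
  · rw [← setLIntegral_congr Ioo_ae_eq_Ioc, ← lintegral_Ioo_rpow hα hR,
      ← lintegral_mul_const _ (hpow _)]
    refine setLIntegral_mono' measurableSet_Ioo fun l hl => ?_
    have h1 : ENNReal.ofReal (l ^ (-hdim X Y a b)) * ∫⁻ w in cyl a b l z, f w ≤ cylMax a b f z :=
      le_iSup₂_of_le l hl.1 le_rfl
    rw [show α - hdim X Y a b - 1 = (α - 1) + -hdim X Y a b by ring,
      ← ofReal_rpow_mul_ofReal_rpow hl.1, mul_assoc]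
    gcongr
  · rw [show α - β = -(β - α) by ring, ← lintegral_Ioi_rpow (by linarith) hR,
      ← lintegral_mul_const _ (hpow _), ← lintegral_const_mul _ ((hpow _).mul_const _)]
    refine setLIntegral_mono' measurableSet_Ioi fun l hl => ?_
    have hl0 : 0 < l := hR.trans hl
    refine (mul_le_mul_right (lintegral_cyl_le (β := β) hp hq hf hl0 z) _).trans_eq ?_
    rw [mul_left_comm, ← mul_assoc (ENNReal.ofReal _), ofReal_rpow_mul_ofReal_rpow hl0]
    ring_nf

/-- Hedberg's inequality. -/
lemma cylPotential_le (hp : 1 < p) (hq : 1 < q) (hf : Measurable f) {α : ℝ} (hα : 0 < α)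
    (hαβ : α < β) (hN : morreyNorm a b p q β f ≠ ∞) (z : X × Y) :
    cylPotential a b α f z ≤
      (ENNReal.ofReal (1 / α) + cylConst X Y p q * ENNReal.ofReal (1 / (β - α))) *
        (cylMax a b f z ^ ((β - α) / β) * morreyNorm a b p q β f ^ (α / β)) := by
  have hβ : 0 < β := hα.trans hαβ
  have hβα : 0 < β - α := by linarith
  set N := morreyNorm a b p q β f with hNdef
  set M := cylMax a b f z with hM
  -- If `N` or `M` vanishes, no optimal radius exists, but then all integrals of `f` over cylinders
  -- at `z` vanish, and so does the potential.
  have hzero : (∀ r : ℝ, 0 < r → ∫⁻ w in cyl a b r z, f w = 0) → cylPotential a b α f z = 0 := by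
    intro h
    rw [cylPotential]
    refine (setLIntegral_congr_fun (g := fun _ => 0) measurableSet_Ioi
      fun l hl => ?_).trans lintegral_zero
    simp only
    rw [h l hl, mul_zero]
  rcases eq_or_ne N 0 with h0 | h0
  · rw [hzero fun r hr => ?_]
    · exact zero_le
    · have := lintegral_cyl_le (a := a) (b := b) (β := β) hp hq hf hr z
      rw [← hNdef, h0, mul_zero, mul_zero] at this
      exact nonpos_iff_eq_zero.1 this
  rcases eq_or_ne M 0 with hM0 | hM0
  · rw [hzero fun r hr => ?_]
    · exact zero_le
    · have : ENNReal.ofReal (r ^ (-hdim X Y a b)) * ∫⁻ w in cyl a b r z, f w ≤ M :=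
        le_iSup₂_of_le r hr le_rfl
      rw [hM0, nonpos_iff_eq_zero, mul_eq_zero] at this
      refine this.resolve_left ?_
      simpa using Real.rpow_pos_of_pos hr _
  rcases eq_or_ne M ∞ with hMt | hMt
  · rw [hMt, ENNReal.top_rpow_of_pos (by positivity), ENNReal.top_mul, ENNReal.mul_top]
    · exact le_top
    · have : ENNReal.ofReal (1 / α) ≠ 0 := by simpa using hα
      exact fun h => this (add_eq_zero.1 h).1
    · simp [ENNReal.rpow_eq_zero_iff, h0, hN]
  have hm : 0 < M.toReal := ENNReal.toReal_pos hM0 hMt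
  have hn : 0 < N.toReal := ENNReal.toReal_pos h0 hN
  set m := M.toReal
  set n := N.toReal
  have hMm : M = ENNReal.ofReal m := (ENNReal.ofReal_toReal hMt).symm
  have hNn : N = ENNReal.ofReal n := (ENNReal.ofReal_toReal hN).symm
  -- This radius balances the near part `R^α m` and the far part `R^(α-β) n`.
  have hR : 0 < (n / m) ^ (1 / β) := by positivity
  refine (cylPotential_le_add hp hq hf hα hαβ hR z).trans_eq ?_
  rw [← hM, ← hNdef]
  have e1 : ((n / m) ^ (1 / β)) ^ α * m = m ^ ((β - α) / β) * n ^ (α / β) := by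
    rw [← Real.rpow_mul (by positivity), Real.div_rpow hn.le hm.le,
      show (β - α) / β = 1 - 1 / β * α by field_simp, Real.rpow_sub hm, Real.rpow_one,
      show α / β = 1 / β * α by ring]
    ring
  have e2 : ((n / m) ^ (1 / β)) ^ (α - β) * n = m ^ ((β - α) / β) * n ^ (α / β) := by
    rw [← Real.rpow_mul (by positivity), Real.div_rpow hn.le hm.le,
      show (β - α) / β = -(1 / β * (α - β)) by ring, Real.rpow_neg hm.le,
      show α / β = 1 / β * (α - β) + 1 by field_simp; ring, Real.rpow_add hn, Real.rpow_one]
    ring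
  have e1' : ENNReal.ofReal (((n / m) ^ (1 / β)) ^ α / α) * M =
      ENNReal.ofReal (1 / α) * (M ^ ((β - α) / β) * N ^ (α / β)) := by
    rw [hMm, hNn, ENNReal.ofReal_rpow_of_pos hm, ENNReal.ofReal_rpow_of_pos hn,
      ← ENNReal.ofReal_mul (by positivity), ← ENNReal.ofReal_mul (by positivity),
      ← ENNReal.ofReal_mul (by positivity), ← e1]
    ring_nf
  have e2' : ENNReal.ofReal (((n / m) ^ (1 / β)) ^ (α - β) / (β - α)) * N =
      ENNReal.ofReal (1 / (β - α)) * (M ^ ((β - α) / β) * N ^ (α / β)) := by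
    rw [hMm, hNn, ENNReal.ofReal_rpow_of_pos hm, ENNReal.ofReal_rpow_of_pos hn,
      ← ENNReal.ofReal_mul (by positivity), ← ENNReal.ofReal_mul (by positivity),
      ← ENNReal.ofReal_mul (by positivity), ← e2]
    congr 1
    ring
  rw [e1', e2', add_mul, mul_assoc]

/-- The fractional integral maps Morrey spaces to Morrey spaces. -/
theorem exists_morreyNorm_cylPotential_le (X Y : Type*) [NormedAddCommGroup X] [NormedSpace ℝ X]
    [FiniteDimensional ℝ X] [MeasureSpace X] [BorelSpace X]
    [(volume : Measure X).IsAddHaarMeasure] [NormedAddCommGroup Y] [NormedSpace ℝ Y]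
    [FiniteDimensional ℝ Y] [MeasureSpace Y] [BorelSpace Y]
    [(volume : Measure Y).IsAddHaarMeasure] {a b : ℕ} {p q β α : ℝ} (ha : a ≠ 0) (hb : b ≠ 0)
    (hp : 1 < p) (hq : 1 < q) (hα : 0 < α) (hαβ : α < β) :
    ∃ C : ℝ≥0, ∀ f : X × Y → ℝ≥0∞, Measurable f → morreyNorm a b p q β f ≠ ∞ →
      morreyNorm a b (β / (β - α) * p) (β / (β - α) * q) (β - α) (cylPotential a b α f) ≤
        C * morreyNorm a b p q β f := by
  have hβ : 0 < β := hα.trans hαβ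
  have hβα : 0 < β - α := by linarith
  have hp0 : 0 < p := by linarith
  have hq0 : 0 < q := by linarith
  set θ := (β - α) / β with hθ
  have hθ0 : 0 < θ := by positivity
  have hαθ : α / β = 1 - θ := by rw [hθ]; field_simp; ring
  have hθ1 : 0 < 1 - θ := by rw [← hαθ]; positivity
  have hp' : 0 < β / (β - α) * p := by positivity
  have hq' : 0 < β / (β - α) * q := by positivity
  obtain ⟨C, hC⟩ := exists_morreyNorm_cylMax_le X Y ha hb hp hq hβ.le
  set D : ℝ≥0∞ := ENNReal.ofReal (1 / α) + cylConst X Y p q * ENNReal.ofReal (1 / (β - α))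
  have hDt : D ≠ ∞ := ENNReal.add_ne_top.2 ⟨ENNReal.ofReal_ne_top,
    ENNReal.mul_ne_top (cylConst_ne_top hp hq) ENNReal.ofReal_ne_top⟩
  have hKt : D * (C : ℝ≥0∞) ^ θ ≠ ∞ :=
    ENNReal.mul_ne_top hDt (ENNReal.rpow_ne_top_of_nonneg hθ0.le ENNReal.coe_ne_top)
  refine ⟨(D * (C : ℝ≥0∞) ^ θ).toNNReal, fun f hf hN => ?_⟩
  rw [ENNReal.coe_toNNReal hKt]
  set N := morreyNorm a b p q β f with hNdef
  have hct : D * N ^ (1 - θ) ≠ ∞ :=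
    ENNReal.mul_ne_top hDt (ENNReal.rpow_ne_top_of_nonneg hθ1.le hN)
  have hle : ∀ z, cylPotential a b α f z ≤ D * N ^ (1 - θ) * cylMax a b f z ^ θ := fun z => by
    refine (cylPotential_le hp hq hf hα hαβ hN z).trans_eq ?_
    rw [← hNdef, hαθ]
    ring
  refine (morreyNorm_mono hp' hq' hle).trans ?_
  rw [morreyNorm_const_mul hp' hq' hct]
  have hpow : morreyNorm a b (β / (β - α) * p) (β / (β - α) * q) (β - α)
      (fun z => cylMax a b f z ^ θ) ≤ (C * N) ^ θ := by
    refine iSup₂_le fun r hr => iSup_le fun z => ?_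
    -- The new Morrey exponent is `θ` times the old one, since `β`, `1 / p` and `1 / q` are all
    -- multiplied by `θ`.
    have e1 : θ * (β / (β - α) * p) = p := by rw [hθ]; field_simp
    have e2 : θ * (β / (β - α) * q) = q := by rw [hθ]; field_simp
    have e3 : morreyExp X Y a b (β / (β - α) * p) (β / (β - α) * q) (β - α) =
        morreyExp X Y a b p q β * θ := by
      rw [morreyExp, morreyExp, hθ]; field_simp
    rw [localNorm, mixedNorm_rpow hθ0 hp', e1, e2, e3, Real.rpow_mul hr.le,
      ← ENNReal.ofReal_rpow_of_pos (by positivity), ← ENNReal.mul_rpow_of_nonneg _ _ hθ0.le]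
    refine ENNReal.rpow_le_rpow (le_trans ?_ (hC f hf)) hθ0.le
    exact le_iSup₂_of_le r hr (le_iSup_of_le z le_rfl)
  refine (mul_le_mul_right hpow _).trans_eq ?_
  rw [ENNReal.mul_rpow_of_nonneg _ _ hθ0.le]
  have : N = N ^ (1 - θ) * N ^ θ := by
    rw [← ENNReal.rpow_add_of_nonneg _ _ hθ1.le hθ0.le]; simp
  conv_rhs => rw [this]
  ring

end Morrey

/-! ### Exchanging the two factors. -/

section Swap

variable {X Y : Type*} [NormedAddCommGroup X] [NormedSpace ℝ X] [FiniteDimensional ℝ X]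
  [MeasureSpace X] [BorelSpace X] [(volume : Measure X).IsAddHaarMeasure]
  [NormedAddCommGroup Y] [NormedSpace ℝ Y] [FiniteDimensional ℝ Y]
  [MeasureSpace Y] [BorelSpace Y] [(volume : Measure Y).IsAddHaarMeasure]

lemma lintegral_cyl_swap (a b : ℕ) (f : X × Y → ℝ≥0∞) (r : ℝ) (z : X × Y) :
    ∫⁻ w in cyl b a r z.swap, f w.swap = ∫⁻ w in cyl a b r z, f w := by
  have h := (Measure.measurePreserving_swap (μ := (volume : Measure Y))
    (ν := (volume : Measure X))).setLIntegral_comp_preimage_emb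
    MeasurableEquiv.prodComm.measurableEmbedding f (cyl a b r z)
  rw [Measure.volume_eq_prod, Measure.volume_eq_prod, ← h]
  congr 2
  ext w
  simp [cyl, and_comm]

lemma hdim_swap (a b : ℕ) : hdim Y X b a = hdim X Y a b := add_comm _ _

lemma cylMax_swap (a b : ℕ) (f : X × Y → ℝ≥0∞) (w : Y × X) :
    cylMax b a (fun w => f w.swap) w = cylMax a b f w.swap := by
  unfold cylMax
  simp_rw [← lintegral_cyl_swap a b f _ w.swap, Prod.swap_swap, hdim_swap (X := X) (Y := Y) a b]

lemma cylPotential_swap (a b : ℕ) (α : ℝ) (f : X × Y → ℝ≥0∞) (w : Y × X) :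
    cylPotential b a α (fun w => f w.swap) w = cylPotential a b α f w.swap := by
  unfold cylPotential
  simp_rw [← lintegral_cyl_swap a b f _ w.swap, Prod.swap_swap, hdim_swap (X := X) (Y := Y) a b]

end Swap

/-! ### Transfer to parabolic balls and the Riesz kernel on space-time. -/

section SpaceTime

variable {d : ℕ}

lemma normE_eq {V : Type*} [ENorm V] (p q β : ℝ) (f : SpaceTime d → V) :
    normE p q β f = morreyNorm 2 1 p q β fun w => ‖f w‖ₑ := by
  unfold normE morreyNorm localNorm mixedNorm morreyExp
  simp only [iSup_prod, pow_one, Module.finrank_self, finrank_euclideanSpace, Fintype.card_fin,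
    Nat.cast_one, Nat.cast_ofNat, mul_one, one_mul]

/-- In `F` the time integral is the inner one, so space becomes the first factor; the dilation
powers and the exponents trade places accordingly. -/
lemma normF_eq {V : Type*} [ENorm V] (p q β : ℝ) (f : SpaceTime d → V) :
    normF p q β f = morreyNorm 1 2 q p β
      fun w : EuclideanSpace ℝ (Fin d) × ℝ => ‖f w.swap‖ₑ := by
  unfold normF morreyNorm localNorm mixedNorm morreyExp
  simp only [iSup_prod, pow_one, Module.finrank_self, finrank_euclideanSpace, Fintype.card_fin,
    Nat.cast_one, Nat.cast_ofNat, mul_one, one_mul, Prod.swap_prod_mk]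
  congr! 3 with r hr
  rw [iSup_comm]
  simp_rw [sub_right_comm β (2 / p)]

lemma measurable_pdist : Measurable fun v : SpaceTime d × SpaceTime d => pdist v.1 v.2 := by
  unfold pdist
  fun_prop

lemma measurableSet_pball (z : SpaceTime d) (r : ℝ) : MeasurableSet (pball z r) :=
  measurableSet_lt (measurable_pdist.comp (measurable_const.prodMk measurable_id))
    measurable_const

lemma pball_subset_cyl (z : SpaceTime d) {r : ℝ} (hr : 0 < r) : pball z r ⊆ cyl 2 1 r z := by
  intro w hw
  have hw' : Real.sqrt |z.1 - w.1| + ‖z.2 - w.2‖ < r := hw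
  constructor
  · rw [Metric.mem_ball, dist_comm, Real.dist_eq]
    refine (Real.sqrt_lt' hr).1 ?_
    linarith [norm_nonneg (z.2 - w.2)]
  · rw [Metric.mem_ball, dist_comm, dist_eq_norm, pow_one]
    linarith [Real.sqrt_nonneg |z.1 - w.1|]

lemma cyl_subset_pball (z : SpaceTime d) {r : ℝ} (hr : 0 < r) :
    cyl 2 1 (r / 2) z ⊆ pball z r := by
  intro w hw
  have h1 := hw.1
  have h2 := hw.2
  rw [Metric.mem_ball, dist_comm, Real.dist_eq] at h1
  rw [Metric.mem_ball, dist_comm, dist_eq_norm, pow_one] at h2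
  have h3 := (Real.sqrt_lt' (half_pos hr)).2 h1
  change Real.sqrt |z.1 - w.1| + ‖z.2 - w.2‖ < r
  linarith

lemma hdim_spaceTime : hdim ℝ (EuclideanSpace ℝ (Fin d)) 2 1 = d + 2 := by
  simp [hdim, add_comm]

/-- The measure of the unit cylinder. -/
def unitVolume (d : ℕ) : ℝ≥0∞ :=
  volume (Metric.ball (0 : ℝ) 1) * volume (Metric.ball (0 : EuclideanSpace ℝ (Fin d)) 1)

lemma volume_cyl (z : SpaceTime d) {r : ℝ} (hr : 0 < r) :
    volume (cyl 2 1 r z) = ENNReal.ofReal (r ^ ((d : ℝ) + 2)) * unitVolume d := by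
  rw [cyl, Measure.volume_eq_prod, Measure.prod_prod, volume_ball_pow _ hr, volume_ball_pow _ hr,
    ← hdim_spaceTime, hdim, ← ofReal_rpow_mul_ofReal_rpow hr, unitVolume]
  ring

lemma unitVolume_ne_zero : unitVolume d ≠ 0 :=
  mul_ne_zero (Metric.measure_ball_pos _ _ one_pos).ne' (Metric.measure_ball_pos _ _ one_pos).ne'

lemma unitVolume_ne_top : unitVolume d ≠ ∞ :=
  ENNReal.mul_ne_top volume_ball_zero_one_ne_top volume_ball_zero_one_ne_top

/-- A ball of radius `r` lies between the cylinders of radii `r / 2` and `r`, whose volumes have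
ratio `2 ^ (d + 2)`. -/
lemma maximal_le {V : Type*} [ENorm V] (f : SpaceTime d → V) (z : SpaceTime d) :
    maximal f z ≤ ENNReal.ofReal (2 ^ ((d : ℝ) + 2)) * (unitVolume d)⁻¹ *
      cylMax 2 1 (fun w => ‖f w‖ₑ) z := by
  refine iSup₂_le fun r hr => ?_
  have h1 : (volume (pball z r))⁻¹ ≤
      ENNReal.ofReal (2 ^ ((d : ℝ) + 2)) * (unitVolume d)⁻¹ *
        ENNReal.ofReal (r ^ (-hdim ℝ (EuclideanSpace ℝ (Fin d)) 2 1)) := by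
    refine (ENNReal.inv_le_inv.2 (measure_mono (cyl_subset_pball z hr))).trans_eq ?_
    rw [volume_cyl z (half_pos hr), hdim_spaceTime,
      ENNReal.mul_inv (Or.inr unitVolume_ne_top) (Or.inr unitVolume_ne_zero),
      ← ENNReal.ofReal_inv_of_pos (by positivity), mul_right_comm,
      ← ENNReal.ofReal_mul (by positivity), Real.rpow_neg hr.le, Real.div_rpow hr.le (by norm_num),
      inv_div, div_eq_mul_inv]
  calc _ ≤ ENNReal.ofReal (2 ^ ((d : ℝ) + 2)) * (unitVolume d)⁻¹ *
        ENNReal.ofReal (r ^ (-hdim ℝ (EuclideanSpace ℝ (Fin d)) 2 1)) *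
          ∫⁻ w in cyl 2 1 r z, ‖f w‖ₑ :=
        mul_le_mul' h1 (lintegral_mono_set (pball_subset_cyl z hr))
    _ ≤ _ := by
        rw [mul_assoc]
        refine mul_le_mul_right ?_ _
        exact le_iSup₂_of_le (f := fun (r : ℝ) (_ : 0 < r) =>
          ENNReal.ofReal (r ^ (-hdim ℝ (EuclideanSpace ℝ (Fin d)) 2 1)) *
            ∫⁻ w in cyl 2 1 r z, ‖f w‖ₑ) r hr le_rfl

lemma measurable_lintegral_pball {g : SpaceTime d → ℝ≥0∞} (hg : Measurable g) (r : ℝ) :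
    Measurable fun z => ∫⁻ w in pball z r, g w := by
  have : ∀ z, ∫⁻ w in pball z r, g w = ∫⁻ w, {v : SpaceTime d × SpaceTime d |
      pdist v.1 v.2 < r}.indicator (fun v => g v.2) (z, w) := fun z => by
    rw [← lintegral_indicator (measurableSet_pball z r)]
    rfl
  simp_rw [this]
  refine Measurable.lintegral_prod_right' (Measurable.indicator (by fun_prop) ?_)
  exact measurableSet_lt measurable_pdist measurable_const

lemma measurable_maximal {V : Type*} [ENorm V] {f : SpaceTime d → V}
    (hf : Measurable fun w => ‖f w‖ₑ) : Measurable (maximal f) := by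
  have hrat : maximal f = fun z => ⨆ (r : ℚ) (_ : 0 < r),
      (volume (pball z r))⁻¹ * ∫⁻ w in pball z r, ‖f w‖ₑ := by
    ext z
    refine le_antisymm (iSup₂_le fun r hr => ?_) (iSup₂_le fun r hr => ?_)
    -- Rational radii suffice: an open ball is the increasing union of its smaller rational ones,
    -- and their inverse volumes are larger.
    · have hU : pball z r = ⋃ s : {s : ℚ // 0 < s ∧ (s : ℝ) < r}, pball z (s.1 : ℝ) := by
        ext w
        refine ⟨fun hw => ?_, fun hw => ?_⟩
        · have hw' : pdist z w < r := hw
          obtain ⟨s, hs1, hs2⟩ := exists_rat_btwn (max_lt hw' hr)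
          rw [max_lt_iff] at hs1
          exact Set.mem_iUnion.2 ⟨⟨s, by exact_mod_cast hs1.2, hs2⟩, hs1.1⟩
        · obtain ⟨s, hs⟩ := Set.mem_iUnion.1 hw
          exact lt_trans (show pdist z w < _ from hs) s.2.2
      have hdir : Directed (· ⊆ ·) fun s : {s : ℚ // 0 < s ∧ (s : ℝ) < r} =>
          pball z (s.1 : ℝ) := by
        intro s t
        rcases le_total s.1 t.1 with h | h
        · exact ⟨t, fun w hw => lt_of_lt_of_le (show pdist z w < _ from hw) (by exact_mod_cast h),
            subset_rfl⟩
        · exact ⟨s, subset_rfl,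
            fun w hw => lt_of_lt_of_le (show pdist z w < _ from hw) (by exact_mod_cast h)⟩
      have hint : ∫⁻ w in pball z r, ‖f w‖ₑ = ⨆ s : {s : ℚ // 0 < s ∧ (s : ℝ) < r},
          ∫⁻ w in pball z (s.1 : ℝ), ‖f w‖ₑ := by
        conv_lhs => rw [hU]
        exact setLIntegral_iUnion_of_directed _ hdir
      rw [hint, ENNReal.mul_iSup]
      refine iSup_le fun s => ?_
      refine le_trans ?_ (le_iSup₂_of_le s.1 s.2.1 le_rfl)
      gcongr
      exact fun w hw => lt_trans (show pdist z w < _ from hw) s.2.2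
    · exact le_iSup₂_of_le (f := fun (r : ℝ) (_ : 0 < r) =>
        (volume (pball z r))⁻¹ * ∫⁻ w in pball z r, ‖f w‖ₑ) (r : ℝ) (by exact_mod_cast hr) le_rfl
  rw [hrat]
  refine Measurable.iSup fun r => Measurable.iSup_Prop _ ?_
  refine Measurable.mul (Measurable.inv ?_) (measurable_lintegral_pball hf r)
  have := measurable_lintegral_pball (d := d) (measurable_const (a := (1 : ℝ≥0∞))) r
  simpa using this

lemma measurable_rieszKernel (α : ℝ) :
    Measurable fun v : SpaceTime d × SpaceTime d => rieszKernel α v.1 v.2 := by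
  unfold rieszKernel
  exact (measurable_pdist.pow_const _).const_div 1

lemma pdist_nonneg (z w : SpaceTime d) : 0 ≤ pdist z w :=
  add_nonneg (Real.sqrt_nonneg _) (norm_nonneg _)

/-- With `s = d + 2 - α > 0`, this is `ρ^(-s) = s ∫_ρ^∞ l^(-s-1) dl`: the kernel superposes
indicators of balls of all radii. -/
lemma ofReal_rieszKernel_le {α : ℝ} (hα : α < d + 2) (z w : SpaceTime d) :
    ENNReal.ofReal (rieszKernel α z w) ≤ ENNReal.ofReal (d + 2 - α) *
      ∫⁻ l in Set.Ioi (0 : ℝ), {l | pdist z w < l}.indicator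
        (fun l => ENNReal.ofReal (l ^ (α - ((d : ℝ) + 2) - 1))) l := by
  have hs : 0 < (d : ℝ) + 2 - α := by linarith
  -- On the diagonal the kernel takes the default value `1 / 0 = 0`, so only an inequality is
  -- claimed.
  rcases (pdist_nonneg z w).eq_or_lt with h0 | h0
  · rw [rieszKernel, ← h0, Real.zero_rpow hs.ne']
    simp
  · have : (∫⁻ l in Set.Ioi (0 : ℝ), {l | pdist z w < l}.indicator
        (fun l => ENNReal.ofReal (l ^ (α - ((d : ℝ) + 2) - 1))) l) =
        ENNReal.ofReal (pdist z w ^ (-((d : ℝ) + 2 - α)) / (d + 2 - α)) := by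
      have e : Set.Ioi (pdist z w) ∩ Set.Ioi 0 = Set.Ioi (pdist z w) :=
        Set.inter_eq_left.2 fun l hl => h0.trans hl
      change ∫⁻ l in Set.Ioi (0 : ℝ), (Set.Ioi (pdist z w)).indicator _ l = _
      rw [lintegral_indicator measurableSet_Ioi, Measure.restrict_restrict measurableSet_Ioi,
        ← lintegral_Ioi_rpow hs h0, e]
      ring_nf
    rw [this, ← ENNReal.ofReal_mul hs.le, mul_div_cancel₀ _ hs.ne', rieszKernel,
      Real.rpow_neg h0.le, one_div]

lemma lintegral_rieszKernel_mul_le {α : ℝ} (hα : α < d + 2) {g : SpaceTime d → ℝ≥0∞}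
    (hg : Measurable g) (z : SpaceTime d) :
    ∫⁻ w, ENNReal.ofReal (rieszKernel α z w) * g w ≤
      ENNReal.ofReal (d + 2 - α) * cylPotential 2 1 α g z := by
  set S : Set (SpaceTime d × ℝ) := {v | pdist z v.1 < v.2}
  have hS : MeasurableSet S := measurableSet_lt
    (measurable_pdist.comp (measurable_const.prodMk measurable_fst)) measurable_snd
  set F : SpaceTime d → ℝ → ℝ≥0∞ := fun w l =>
    S.indicator (fun v => ENNReal.ofReal (v.2 ^ (α - ((d : ℝ) + 2) - 1)) * g v.1) (w, l) with hF
  have hFm : Measurable (Function.uncurry F) :=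
    Measurable.indicator (f := fun v : SpaceTime d × ℝ =>
      ENNReal.ofReal (v.2 ^ (α - ((d : ℝ) + 2) - 1)) * g v.1) (by fun_prop) hS
  calc _ ≤ ∫⁻ w, ENNReal.ofReal (d + 2 - α) * ∫⁻ l in Set.Ioi (0 : ℝ), F w l := by
        refine lintegral_mono fun w => ?_
        refine (mul_le_mul_left (ofReal_rieszKernel_le hα z w) _).trans_eq ?_
        rw [mul_assoc, ← lintegral_mul_const]
        · congr 2
          ext l
          simp [hF, S, Set.indicator_apply]
        · exact Measurable.indicator (by fun_prop) measurableSet_Ioi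
    _ = ENNReal.ofReal (d + 2 - α) * ∫⁻ l in Set.Ioi (0 : ℝ), ∫⁻ w, F w l := by
        rw [lintegral_const_mul' _ _ ENNReal.ofReal_ne_top,
          lintegral_lintegral_swap hFm.aemeasurable]
    _ ≤ _ := by
        refine mul_le_mul_right (setLIntegral_mono' measurableSet_Ioi fun l hl => ?_) _
        have e : ∀ w, F w l = (pball z l).indicator
            (fun w => ENNReal.ofReal (l ^ (α - ((d : ℝ) + 2) - 1)) * g w) w := fun w => by
          simp [hF, S, pball, Set.indicator_apply]
        simp_rw [e]
        rw [lintegral_indicator (measurableSet_pball z l), lintegral_const_mul _ hg,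
          hdim_spaceTime]
        exact mul_le_mul_right (lintegral_mono_set (pball_subset_cyl z hl)) _

lemma cyl_mem_nhds (z : SpaceTime d) : cyl 2 1 1 z ∈ nhds z :=
  prod_mem_nhds (Metric.ball_mem_nhds _ (by positivity))
    (Metric.ball_mem_nhds _ (by positivity))

lemma locallyIntegrable_of_lintegral_cyl {V : Type*} [TopologicalSpace V] [ContinuousENorm V]
    {f : SpaceTime d → V} (hf : AEStronglyMeasurable f)
    (h : ∀ z, ∫⁻ w in cyl 2 1 1 z, ‖f w‖ₑ < ∞) : LocallyIntegrable f := by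
  intro z
  exact ⟨cyl 2 1 1 z, cyl_mem_nhds z, hf.restrict, h z⟩

/-- The properties common to the norms of `E_{p,q,β}` and `F_{p,q,β}`. -/
structure IsLocalNorm (N : (SpaceTime d → ℝ≥0∞) → ℝ≥0∞) : Prop where
  mono : ∀ {f g : SpaceTime d → ℝ≥0∞}, (∀ z, f z ≤ g z) → N f ≤ N g
  const_mul : ∀ {c : ℝ≥0∞} {f : SpaceTime d → ℝ≥0∞}, c ≠ ∞ → N (fun z => c * f z) = c * N f
  congr_ae : ∀ {f g : SpaceTime d → ℝ≥0∞}, f =ᵐ[volume] g → N f = N g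
  lintegral_lt_top : ∀ {f : SpaceTime d → ℝ≥0∞}, Measurable f → N f < ∞ →
    ∀ z, ∫⁻ w in cyl 2 1 1 z, f w < ∞

lemma isLocalNorm_E {p q : ℝ} (hp : 1 < p) (hq : 1 < q) (β : ℝ) :
    IsLocalNorm (d := d) (normE p q β) := by
  have e : (normE p q β : (SpaceTime d → ℝ≥0∞) → ℝ≥0∞) = morreyNorm 2 1 p q β :=
    funext fun f => normE_eq p q β f
  rw [e]
  refine ⟨morreyNorm_mono (by linarith) (by linarith),
    morreyNorm_const_mul (by linarith) (by linarith), morreyNorm_congr_ae, fun hf hN z => ?_⟩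
  refine (lintegral_cyl_le (β := β) hp hq hf one_pos z).trans_lt ?_
  exact ENNReal.mul_lt_top (cylConst_ne_top hp hq).lt_top
    (ENNReal.mul_lt_top ENNReal.ofReal_lt_top hN)

lemma isLocalNorm_F {p q : ℝ} (hp : 1 < p) (hq : 1 < q) (β : ℝ) :
    IsLocalNorm (d := d) (normF p q β) := by
  have e : (normF p q β : (SpaceTime d → ℝ≥0∞) → ℝ≥0∞) =
      fun f => morreyNorm 1 2 q p β fun w => f w.swap :=
    funext fun f => normF_eq p q β f
  rw [e]
  refine ⟨fun h => morreyNorm_mono (by linarith) (by linarith) fun w => h w.swap,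
    morreyNorm_const_mul (by linarith) (by linarith), fun h => morreyNorm_congr_ae ?_,
    fun {f} hf hN z => ?_⟩
  · have hs : Filter.Tendsto (Prod.swap : EuclideanSpace ℝ (Fin d) × ℝ → SpaceTime d)
        (ae volume) (ae volume) :=
      (Measure.measurePreserving_swap (μ := (volume : Measure (EuclideanSpace ℝ (Fin d))))
        (ν := (volume : Measure ℝ))).quasiMeasurePreserving.tendsto_ae
    exact hs.eventually h
  · rw [← lintegral_cyl_swap 2 1 f]
    refine (lintegral_cyl_le (β := β) hq hp (f := fun w => f w.swap)
      (hf.comp measurable_swap) one_pos z.swap).trans_lt ?_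
    exact ENNReal.mul_lt_top (cylConst_ne_top hq hp).lt_top
      (ENNReal.mul_lt_top ENNReal.ofReal_lt_top hN)

variable {𝕜 : Type*} [RCLike 𝕜]

/-- A measurable representative of `f` has the same maximal function everywhere. Local integrability
of the result follows from finiteness of its norm. -/
lemma IsLocalNorm.maximal_bound {N : (SpaceTime d → ℝ≥0∞) → ℝ≥0∞} (hN : IsLocalNorm N)
    (h : ∃ C : ℝ≥0, ∀ g : SpaceTime d → ℝ≥0∞, Measurable g → N (cylMax 2 1 g) ≤ C * N g) :
    ∃ C : ℝ≥0, ∀ f : SpaceTime d → 𝕜, AEStronglyMeasurable f → N (fun z => ‖f z‖ₑ) < ∞ →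
      LocallyIntegrable (maximal f) ∧ N (maximal f) ≤ C * N (fun z => ‖f z‖ₑ) := by
  obtain ⟨C, hC⟩ := h
  set D : ℝ≥0∞ := ENNReal.ofReal (2 ^ ((d : ℝ) + 2)) * (unitVolume d)⁻¹ with hD
  have hDt : D ≠ ∞ := ENNReal.mul_ne_top ENNReal.ofReal_ne_top
    (ENNReal.inv_ne_top.2 unitVolume_ne_zero)
  refine ⟨D.toNNReal * C, fun f hf hfin => ?_⟩
  set f' := hf.mk f
  have hf' : StronglyMeasurable f' := hf.stronglyMeasurable_mk
  have hae : f =ᵐ[volume] f' := hf.ae_eq_mk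
  have hae' : (fun z => ‖f z‖ₑ) =ᵐ[volume] fun z => ‖f' z‖ₑ := hae.fun_comp enorm
  have hmax : maximal f = maximal f' := by
    ext z
    unfold maximal
    congr! 4 with r hr
    exact lintegral_congr_ae (ae_restrict_of_ae hae')
  have hm : Measurable (maximal f') := measurable_maximal hf'.enorm
  have hbound : N (maximal f) ≤ (D.toNNReal * C : ℝ≥0) * N (fun z => ‖f z‖ₑ) := by
    rw [hmax, hN.congr_ae hae']
    push_cast
    rw [ENNReal.coe_toNNReal hDt, mul_assoc]
    refine (hN.mono (maximal_le f')).trans ?_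
    rw [hN.const_mul hDt]
    exact mul_le_mul_right (hC _ hf'.enorm) _
  refine ⟨locallyIntegrable_of_lintegral_cyl (hmax ▸ hm.aestronglyMeasurable) fun z => ?_, hbound⟩
  simp only [enorm_eq_self]
  refine hN.lintegral_lt_top (hmax ▸ hm) ?_ z
  exact hbound.trans_lt (ENNReal.mul_lt_top ENNReal.coe_lt_top hfin)

/-- All conclusions come from the potential `J` of the absolute values: its `N'`-norm is bounded,
hence it is locally integrable and finite almost everywhere, which is absolute convergence, and it
dominates the norm of `riesz α f`. -/
lemma IsLocalNorm.riesz_bound {N N' : (SpaceTime d → ℝ≥0∞) → ℝ≥0∞} (hN : IsLocalNorm N)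
    (hN' : IsLocalNorm N') {α : ℝ} (hα : α < d + 2)
    (h : ∃ C : ℝ≥0, ∀ g : SpaceTime d → ℝ≥0∞, Measurable g → N g ≠ ∞ →
      N' (cylPotential 2 1 α g) ≤ C * N g) :
    ∃ C : ℝ≥0, ∀ f : SpaceTime d → 𝕜, AEStronglyMeasurable f → N (fun z => ‖f z‖ₑ) < ∞ →
      (∀ᵐ z, RieszConverges α f z) ∧ LocallyIntegrable (riesz α f) ∧
      N' (fun z => ‖riesz α f z‖ₑ) ≤ C * N (fun z => ‖f z‖ₑ) := by
  obtain ⟨C, hC⟩ := h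
  set D : ℝ≥0∞ := ENNReal.ofReal (d + 2 - α) with hD
  have hDt : D ≠ ∞ := ENNReal.ofReal_ne_top
  refine ⟨D.toNNReal * C, fun f hf hfin => ?_⟩
  set f' := hf.mk f
  have hf' : StronglyMeasurable f' := hf.stronglyMeasurable_mk
  have hae : f =ᵐ[volume] f' := hf.ae_eq_mk
  have hae' : (fun z => ‖f z‖ₑ) =ᵐ[volume] fun z => ‖f' z‖ₑ := hae.fun_comp enorm
  have haeK : ∀ z, (fun w => rieszKernel α z w • f w) =ᵐ[volume]
      fun w => rieszKernel α z w • f' w := fun z => by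
    filter_upwards [hae] with w hw
    rw [hw]
  have hR : riesz α f = riesz α f' := funext fun z => integral_congr_ae (haeK z)
  have hKf : StronglyMeasurable fun v : SpaceTime d × SpaceTime d =>
      rieszKernel α v.1 v.2 • f' v.2 :=
    (measurable_rieszKernel α).stronglyMeasurable.smul (hf'.comp_measurable measurable_snd)
  set J : SpaceTime d → ℝ≥0∞ := fun z => ∫⁻ w, ‖rieszKernel α z w • f' w‖ₑ with hJ
  have hJm : Measurable J := hKf.enorm.lintegral_prod_right'
  have hJle : ∀ z, J z ≤ D * cylPotential 2 1 α (fun w => ‖f' w‖ₑ) z := fun z => by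
    refine le_trans (le_of_eq ?_) (lintegral_rieszKernel_mul_le hα hf'.enorm z)
    refine lintegral_congr fun w => ?_
    rw [enorm_smul, Real.enorm_of_nonneg]
    exact div_nonneg zero_le_one (Real.rpow_nonneg (pdist_nonneg z w) _)
  have hJN : N' J ≤ (D.toNNReal * C : ℝ≥0) * N (fun z => ‖f z‖ₑ) := by
    rw [hN.congr_ae hae'] at hfin ⊢
    push_cast
    rw [ENNReal.coe_toNNReal hDt, mul_assoc]
    refine (hN'.mono hJle).trans ?_
    rw [hN'.const_mul hDt]
    exact mul_le_mul_right (hC _ hf'.enorm hfin.ne) _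
  have hJfin : ∀ z, ∫⁻ w in cyl 2 1 1 z, J w < ∞ := hN'.lintegral_lt_top hJm
    (hJN.trans_lt (ENNReal.mul_lt_top ENNReal.coe_lt_top hfin))
  have hle : ∀ z, ‖riesz α f z‖ₑ ≤ J z := fun z => by
    rw [hR]
    exact enorm_integral_le_lintegral_enorm _
  have hRm : StronglyMeasurable (riesz α f) := by
    rw [hR]
    exact hKf.integral_prod_right'
  refine ⟨?_, locallyIntegrable_of_lintegral_cyl hRm.aestronglyMeasurable fun z =>
    (lintegral_mono fun w => hle w).trans_lt (hJfin z), (hN'.mono hle).trans hJN⟩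
  -- Countably many unit cylinders cover space-time, and `J` has finite integral over each.
  have hJae : ∀ᵐ z, J z < ∞ := by
    obtain ⟨s, hs, hcov⟩ := TopologicalSpace.countable_cover_nhds (cyl_mem_nhds (d := d))
    rw [← Measure.restrict_univ (μ := volume), ← hcov, ae_restrict_biUnion_iff _ hs]
    exact fun z _ => ae_lt_top hJm (hJfin z).ne
  filter_upwards [hJae] with z hz
  refine Integrable.congr ⟨?_, hz⟩ (haeK z).symm
  exact (hKf.comp_measurable (measurable_prodMk_left (x := z))).aestronglyMeasurable

end SpaceTime

/-! ### The bounds for `E` and `F`. -/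

section MainBounds

variable {d : ℕ} {p q β : ℝ}

lemma exists_normE_cylMax_le (hp : 1 < p) (hq : 1 < q) (hβ : 0 ≤ β) :
    ∃ C : ℝ≥0, ∀ g : SpaceTime d → ℝ≥0∞, Measurable g →
      normE p q β (cylMax 2 1 g) ≤ C * normE p q β g := by
  obtain ⟨C, hC⟩ := exists_morreyNorm_cylMax_le ℝ (EuclideanSpace ℝ (Fin d)) (a := 2) (b := 1)
    two_ne_zero one_ne_zero hp hq hβ
  refine ⟨C, fun g hg => ?_⟩
  rw [normE_eq, normE_eq]
  exact hC g hg

lemma exists_normF_cylMax_le (hp : 1 < p) (hq : 1 < q) (hβ : 0 ≤ β) :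
    ∃ C : ℝ≥0, ∀ g : SpaceTime d → ℝ≥0∞, Measurable g →
      normF p q β (cylMax 2 1 g) ≤ C * normF p q β g := by
  obtain ⟨C, hC⟩ := exists_morreyNorm_cylMax_le (EuclideanSpace ℝ (Fin d)) ℝ (a := 1) (b := 2)
    one_ne_zero two_ne_zero hq hp hβ
  refine ⟨C, fun g hg => ?_⟩
  rw [normF_eq, normF_eq]
  simp only [enorm_eq_self, ← cylMax_swap]
  exact hC _ (hg.comp measurable_swap)

lemma exists_normE_cylPotential_le (hp : 1 < p) (hq : 1 < q) {α : ℝ} (hα : 0 < α) (hαβ : α < β) :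
    ∃ C : ℝ≥0, ∀ g : SpaceTime d → ℝ≥0∞, Measurable g → normE p q β g ≠ ∞ →
      normE (β / (β - α) * p) (β / (β - α) * q) (β - α) (cylPotential 2 1 α g) ≤
        C * normE p q β g := by
  obtain ⟨C, hC⟩ := exists_morreyNorm_cylPotential_le ℝ (EuclideanSpace ℝ (Fin d)) (a := 2)
    (b := 1) two_ne_zero one_ne_zero hp hq hα hαβ
  refine ⟨C, fun g hg hN => ?_⟩
  rw [normE_eq] at hN ⊢
  rw [normE_eq]
  exact hC g hg hN

lemma exists_normF_cylPotential_le (hp : 1 < p) (hq : 1 < q) {α : ℝ} (hα : 0 < α) (hαβ : α < β) :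
    ∃ C : ℝ≥0, ∀ g : SpaceTime d → ℝ≥0∞, Measurable g → normF p q β g ≠ ∞ →
      normF (β / (β - α) * p) (β / (β - α) * q) (β - α) (cylPotential 2 1 α g) ≤
        C * normF p q β g := by
  obtain ⟨C, hC⟩ := exists_morreyNorm_cylPotential_le (EuclideanSpace ℝ (Fin d)) ℝ (a := 1)
    (b := 2) one_ne_zero two_ne_zero hq hp hα hαβ
  refine ⟨C, fun g hg hN => ?_⟩
  rw [normF_eq] at hN ⊢
  rw [normF_eq]
  simp only [enorm_eq_self, ← cylPotential_swap] at hN ⊢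
  exact hC _ (hg.comp measurable_swap) hN

lemma normE_enorm {V : Type*} [ENorm V] (f : SpaceTime d → V) :
    normE p q β (fun z => ‖f z‖ₑ) = normE p q β f := by
  simp only [normE, enorm_eq_self]

lemma normF_enorm {V : Type*} [ENorm V] (f : SpaceTime d → V) :
    normF p q β (fun z => ‖f z‖ₑ) = normF p q β f := by
  simp only [normF, enorm_eq_self]

variable {𝕜 : Type*} [RCLike 𝕜]

/-- The target exponents stay above `1`, as required for the target norm to control local integrals.
-/
lemma one_lt_div_sub_mul {α : ℝ} (hα : 0 < α) (hαβ : α < β) (hp : 1 < p) :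
    1 < β / (β - α) * p := by
  have : 1 < β / (β - α) := by rw [one_lt_div (by linarith)]; linarith
  nlinarith

lemma exists_riesz_bound_E (hp : 1 < p) (hq : 1 < q) {α : ℝ} (hα : 0 < α) (hαβ : α < β)
    (hαd : α < d + 2) :
    ∃ C : ℝ≥0, ∀ f : SpaceTime d → 𝕜, MemE p q β f →
      (∀ᵐ z, RieszConverges α f z) ∧
      MemE (β / (β - α) * p) (β / (β - α) * q) (β - α) (riesz α f) ∧
      normE (β / (β - α) * p) (β / (β - α) * q) (β - α) (riesz α f) ≤ C * normE p q β f := by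
  obtain ⟨C, hC⟩ := (isLocalNorm_E (d := d) hp hq β).riesz_bound (𝕜 := 𝕜)
    (isLocalNorm_E (one_lt_div_sub_mul hα hαβ hp) (one_lt_div_sub_mul hα hαβ hq) (β - α)) hαd
    (exists_normE_cylPotential_le hp hq hα hαβ)
  simp only [normE_enorm] at hC
  refine ⟨C, fun f ⟨hf, hN⟩ => ?_⟩
  obtain ⟨h1, h2, h3⟩ := hC f hf.aestronglyMeasurable hN
  exact ⟨h1, ⟨h2, h3.trans_lt (ENNReal.mul_lt_top ENNReal.coe_lt_top hN)⟩, h3⟩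

lemma exists_riesz_bound_F (hp : 1 < p) (hq : 1 < q) {α : ℝ} (hα : 0 < α) (hαβ : α < β)
    (hαd : α < d + 2) :
    ∃ C : ℝ≥0, ∀ f : SpaceTime d → 𝕜, MemF p q β f →
      (∀ᵐ z, RieszConverges α f z) ∧
      MemF (β / (β - α) * p) (β / (β - α) * q) (β - α) (riesz α f) ∧
      normF (β / (β - α) * p) (β / (β - α) * q) (β - α) (riesz α f) ≤ C * normF p q β f := by
  obtain ⟨C, hC⟩ := (isLocalNorm_F (d := d) hp hq β).riesz_bound (𝕜 := 𝕜)
    (isLocalNorm_F (one_lt_div_sub_mul hα hαβ hp) (one_lt_div_sub_mul hα hαβ hq) (β - α)) hαd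
    (exists_normF_cylPotential_le hp hq hα hαβ)
  simp only [normF_enorm] at hC
  refine ⟨C, fun f ⟨hf, hN⟩ => ?_⟩
  obtain ⟨h1, h2, h3⟩ := hC f hf.aestronglyMeasurable hN
  exact ⟨h1, ⟨h2, h3.trans_lt (ENNReal.mul_lt_top ENNReal.coe_lt_top hN)⟩, h3⟩

lemma exists_maximal_bound_E (hp : 1 < p) (hq : 1 < q) (hβ : 0 ≤ β) :
    ∃ C : ℝ≥0, ∀ f : SpaceTime d → 𝕜, MemE p q β f →
      MemE p q β (maximal f) ∧ normE p q β (maximal f) ≤ C * normE p q β f := by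
  obtain ⟨C, hC⟩ := (isLocalNorm_E (d := d) hp hq β).maximal_bound (𝕜 := 𝕜)
    (exists_normE_cylMax_le hp hq hβ)
  simp only [normE_enorm] at hC
  refine ⟨C, fun f ⟨hf, hN⟩ => ?_⟩
  obtain ⟨h1, h2⟩ := hC f hf.aestronglyMeasurable hN
  exact ⟨⟨h1, h2.trans_lt (ENNReal.mul_lt_top ENNReal.coe_lt_top hN)⟩, h2⟩

lemma exists_maximal_bound_F (hp : 1 < p) (hq : 1 < q) (hβ : 0 ≤ β) :
    ∃ C : ℝ≥0, ∀ f : SpaceTime d → 𝕜, MemF p q β f →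
      MemF p q β (maximal f) ∧ normF p q β (maximal f) ≤ C * normF p q β f := by
  obtain ⟨C, hC⟩ := (isLocalNorm_F (d := d) hp hq β).maximal_bound (𝕜 := 𝕜)
    (exists_normF_cylMax_le hp hq hβ)
  simp only [normF_enorm] at hC
  refine ⟨C, fun f ⟨hf, hN⟩ => ?_⟩
  obtain ⟨h1, h2⟩ := hC f hf.aestronglyMeasurable hN
  exact ⟨⟨h1, h2.trans_lt (ENNReal.mul_lt_top ENNReal.coe_lt_top hN)⟩, h2⟩

end MainBounds

end ParabolicMorrey
end

theorem mainTheorem6 {𝕜 : Type*} [RCLike 𝕜] (d : ℕ) (p q β : ℝ) (hp : 1 < p) (hq : 1 < q)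
    (hβ : 0 < β) (hβ' : β < 2 / p + d / q) :
    -- the maximal operator
    (∃ C : ℝ≥0, ∀ f : SpaceTime d → 𝕜, MemE p q β f →
      MemE p q β (maximal f) ∧ normE p q β (maximal f) ≤ C * normE p q β f) ∧
    (∃ C : ℝ≥0, ∀ f : SpaceTime d → 𝕜, MemF p q β f →
      MemF p q β (maximal f) ∧ normF p q β (maximal f) ≤ C * normF p q β f) ∧
    -- the Riesz potential of order 1
    (1 < β →
      (∃ C : ℝ≥0, ∀ f : SpaceTime d → 𝕜, MemE p q β f →
        (∀ᵐ z, RieszConverges 1 f z) ∧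
        MemE (β / (β - 1) * p) (β / (β - 1) * q) (β - 1) (riesz 1 f) ∧
        normE (β / (β - 1) * p) (β / (β - 1) * q) (β - 1) (riesz 1 f) ≤ C * normE p q β f) ∧
      (∃ C : ℝ≥0, ∀ f : SpaceTime d → 𝕜, MemF p q β f →
        (∀ᵐ z, RieszConverges 1 f z) ∧
        MemF (β / (β - 1) * p) (β / (β - 1) * q) (β - 1) (riesz 1 f) ∧
        normF (β / (β - 1) * p) (β / (β - 1) * q) (β - 1) (riesz 1 f) ≤ C * normF p q β f)) ∧
    -- the Riesz potential of order 2
    (2 < β →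
      (∃ C : ℝ≥0, ∀ f : SpaceTime d → 𝕜, MemE p q β f →
        (∀ᵐ z, RieszConverges 2 f z) ∧
        MemE (β / (β - 2) * p) (β / (β - 2) * q) (β - 2) (riesz 2 f) ∧
        normE (β / (β - 2) * p) (β / (β - 2) * q) (β - 2) (riesz 2 f) ≤ C * normE p q β f) ∧
      (∃ C : ℝ≥0, ∀ f : SpaceTime d → 𝕜, MemF p q β f →
        (∀ᵐ z, RieszConverges 2 f z) ∧
        MemF (β / (β - 2) * p) (β / (β - 2) * q) (β - 2) (riesz 2 f) ∧
        normF (β / (β - 2) * p) (β / (β - 2) * q) (β - 2) (riesz 2 f) ≤ C * normF p q β f)) := by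
  refine ⟨exists_maximal_bound_E hp hq hβ.le, exists_maximal_bound_F hp hq hβ.le,
    fun h1 => ?_, fun h2 => ?_⟩
  · have hd : (1 : ℝ) < d + 2 := by linarith [(d.cast_nonneg : (0 : ℝ) ≤ d)]
    exact ⟨exists_riesz_bound_E hp hq one_pos h1 hd, exists_riesz_bound_F hp hq one_pos h1 hd⟩
  · have hd : (2 : ℝ) < d + 2 := by
      -- For `d = 0` the order `2` equals the homogeneous dimension, but then `β < 2 / p < 2`
      -- contradicts `2 < β`.
      rcases Nat.eq_zero_or_pos d with rfl | hd
      · have : 2 / p < 2 := by rw [div_lt_iff₀ (by linarith)]; linarith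
        simp at hβ'
        linarith
      · have : (0 : ℝ) < d := by exact_mod_cast hd
        linarith
    exact ⟨exists_riesz_bound_E hp hq two_pos h2 hd, exists_riesz_bound_F hp hq two_pos h2 hd⟩
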